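/- Let $n\ge 1$ and let $B^n$ be the closed Euclidean unit ball of $\mathbb{R}^n$. All bodies are origin-symmetric convex bodies (compact, convex, with nonempty interior, $-K=K$). A lattice $\Lambda\subset\mathbb{R}^n$ (discrete, of full rank, of determinant $d(\Lambda)$) is a covering lattice for $K$ if $\bigcup_{l\in\Lambda}(K+l)=\mathbb{R}^n$; the critical determinant $d_K$ is the maximum of $d(\Lambda)$ over the covering lattices $\Lambda$ for $K$, and a covering lattice with $d(\Lambda)=d_K$ is called critical. The body $K$ is inextensible if $d_{K'}>d_K$ for every body $K'\supsetneq K$, and extensible otherwise. Let $P_0=\{x:\|x\|\le\|x-l\|\text{ for all }l\in\Lambda\}$ be the Voronoi polytope of $\Lambda$. The lattice $\Lambda$ is generic if, for all linear maps $T$ sufficiently close to the identity, the Voronoi polytope of $T\Lambda$ has the same combinatorial type (isomorphic face lattice) as $P_0$. For generic $\Lambda$, each class of vertices of $P_0$ modulo translation by $\Lambda$ is the vertex set of a simplex with circumcenter $0$; these are the primitive simplices of $\Lambda$, and $X(\Lambda)$ denotes the set of those with the largest circumradius. To a primitive simplex $S$ with vertices $x_1,\dots,x_{n+1}$ one associates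 the symmetric map $Q_S(\cdot)=\sum_j\alpha_j\langle x_j,\cdot\rangle x_j$, where $\sum_j\alpha_jx_j=0$ and $\sum_j\alpha_j=1$. A set $X$ of such simplices is semi-eutactic if $\mathrm{Id}=\sum_{S\in X}\upsilon_SQ_S$ for some coefficients $\upsilon_S\ge 0$, and redundantly semi-eutactic if $X\setminus\{S,-S\}$ is semi-eutactic for every $S\in X$. Theorem. Suppose that $\Lambda_0$ is a critical covering lattice of $B^n$, that it is unique up to rotation (every critical covering lattice of $B^n$ is $U\Lambda_0$ for some orthogonal map $U$), and that $\Lambda_0$ is generic. Then $B^n$ is extensible if and only if $X(\Lambda_0)$ is redundantly semi-eutactic. -/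

import Mathlib

open scoped Topology

namespace BallCovering

noncomputable section

/-- The Euclidean space of dimension `n`. -/
abbrev Euc (n : ℕ) : Type := EuclideanSpace ℝ (Fin n)

/-- An origin-symmetric convex body. -/
structure IsSymmetricBody {n : ℕ} (K : Set (Euc n)) : Prop where
  convex : Convex ℝ K
  isCompact : IsCompact K
  interior_nonempty : (interior K).Nonempty
  neg_mem : ∀ x ∈ K, -x ∈ K

/-- The closed Euclidean unit ball. -/
def unitBall (n : ℕ) : Set (Euc n) := Metric.closedBall 0 1

/-- An `n`-dimensional lattice: a discrete subgroup of full rank. -/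
def IsLattice {n : ℕ} (L : Submodule ℤ (Euc n)) : Prop :=
  ∃ _ : DiscreteTopology L, IsZLattice ℝ L

/-- The image of `L` under a linear map. -/
def latticeImage {n : ℕ} (T : Euc n →ₗ[ℝ] Euc n) (L : Submodule ℤ (Euc n)) :
    Submodule ℤ (Euc n) :=
  L.map (T.restrictScalars ℤ)

/-- `L` is a covering lattice for `K`: the translates `K + l`, `l ∈ L`, cover the space. -/
def IsCoveringLattice {n : ℕ} (K : Set (Euc n)) (L : Submodule ℤ (Euc n)) : Prop :=
  IsLattice L ∧ ∀ x : Euc n, ∃ l ∈ L, x - l ∈ K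

/-- The critical covering determinant of `K`: the largest determinant (covolume) of a covering
lattice for `K`. -/
def criticalDet {n : ℕ} (K : Set (Euc n)) : ℝ :=
  sSup {d : ℝ | ∃ L : Submodule ℤ (Euc n), IsCoveringLattice K L ∧ d = ZLattice.covolume L}

/-- A critical covering lattice attains the critical determinant. -/
def IsCriticalLattice {n : ℕ} (K : Set (Euc n)) (L : Submodule ℤ (Euc n)) : Prop :=
  IsCoveringLattice K L ∧ ZLattice.covolume L = criticalDet K

/-- `K` is inextensible: every strictly larger origin-symmetric convex body has a strictly larger
critical determinant. -/
def Inextensible {n : ℕ} (K : Set (Euc n)) : Prop :=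
  ∀ K' : Set (Euc n), IsSymmetricBody K' → K ⊂ K' → criticalDet K < criticalDet K'

def Extensible {n : ℕ} (K : Set (Euc n)) : Prop := ¬ Inextensible K

/-- `L` is the unique critical covering lattice of `K`, up to orthogonal maps. -/
def IsUniqueCriticalLattice {n : ℕ} (K : Set (Euc n)) (L : Submodule ℤ (Euc n)) : Prop :=
  IsCriticalLattice K L ∧
    ∀ L' : Submodule ℤ (Euc n), IsCriticalLattice K L' →
      ∃ U : Euc n ≃ₗᵢ[ℝ] Euc n, L' = latticeImage U.toLinearEquiv.toLinearMap L

/-- The Voronoi polytope of the lattice point `0`. -/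
def voronoiPolytope {n : ℕ} (L : Submodule ℤ (Euc n)) : Set (Euc n) :=
  {x | ∀ l ∈ L, ‖x‖ ≤ ‖x - l‖}

/-- The faces of a polytope `P`, ordered by inclusion: the exposed subsets of `P`
(among them `∅` and `P` itself). -/
abbrev FaceLattice {n : ℕ} (P : Set (Euc n)) : Type := {F : Set (Euc n) // IsExposed ℝ P F}

/-- Two polytopes have the same combinatorial type: their face lattices are isomorphic. -/
def SameCombinatorialType {n : ℕ} (P P' : Set (Euc n)) : Prop :=
  Nonempty (FaceLattice P ≃o FaceLattice P')

/-- `L` is generic: the Voronoi polytope has the same combinatorial type for all lattices in a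
neighbourhood of `L`, that is, for all `T L` with `T` close enough to the identity (such `T` are
nonsingular). -/
def Generic {n : ℕ} (L : Submodule ℤ (Euc n)) : Prop :=
  ∀ᶠ T : Euc n →L[ℝ] Euc n in 𝓝 (ContinuousLinearMap.id ℝ (Euc n)),
    SameCombinatorialType (voronoiPolytope (latticeImage T.toLinearMap L)) (voronoiPolytope L)

/-- The vertices of the Voronoi polytope of `0`. -/
def voronoiVertices {n : ℕ} (L : Submodule ℤ (Euc n)) : Set (Euc n) :=
  (voronoiPolytope L).extremePoints ℝ

/-- A primitive simplex of a (generic) lattice `L`, given by its vertex set: a class of vertices of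
the Voronoi polytope modulo translation by vectors of `L`. -/
def IsPrimitiveSimplex {n : ℕ} (L : Submodule ℤ (Euc n)) (S : Finset (Euc n)) : Prop :=
  ∃ x ∈ voronoiVertices L, (S : Set (Euc n)) = {y | y ∈ voronoiVertices L ∧ y - x ∈ L}

/-- The circumradius of a simplex with vertex set `S`: the radius of the sphere through the points
of `S` (the smallest one, if there are several). -/
def circumradius {n : ℕ} (S : Finset (Euc n)) : ℝ :=
  sInf {r : ℝ | 0 ≤ r ∧ ∃ c : Euc n, ∀ x ∈ S, dist x c = r}

/-- The set `X(L)` of maximal primitive simplices: those of largest circumradius. -/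
def maximalSimplices {n : ℕ} (L : Submodule ℤ (Euc n)) : Set (Finset (Euc n)) :=
  {S | IsPrimitiveSimplex L S ∧
    ∀ S' : Finset (Euc n), IsPrimitiveSimplex L S' → circumradius S' ≤ circumradius S}

/-- `Q` is the symmetric map `Q_S = ∑ α_x ⟨x, ·⟩ x` of the simplex with vertex set `S` and
circumcenter `0`, where `α` are the barycentric coordinates of `0` with respect to `S`. They exist
and are unique when the `n + 1` points of `S` are affinely independent. -/
def IsSimplexMap {n : ℕ} (S : Finset (Euc n)) (Q : Euc n →ₗ[ℝ] Euc n) : Prop :=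
  ∃ α : Euc n → ℝ, ∑ x ∈ S, α x • x = 0 ∧ ∑ x ∈ S, α x = 1 ∧
    ∀ v : Euc n, Q v = ∑ x ∈ S, (α x * inner ℝ x v) • x

/-- A set of maps is semi-eutactic if the identity is a combination of its elements with
nonnegative coefficients. -/
def SemiEutacticMaps {n : ℕ} (A : Set (Euc n →ₗ[ℝ] Euc n)) : Prop :=
  ∃ u : (Euc n →ₗ[ℝ] Euc n) →₀ ℝ, (u.support : Set (Euc n →ₗ[ℝ] Euc n)) ⊆ A ∧
    (∀ Q, 0 ≤ u Q) ∧ LinearMap.id = u.sum fun Q c => c • Q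

/-- A set of simplices is semi-eutactic if the set of their associated maps is. -/
def SemiEutactic {n : ℕ} (X : Set (Finset (Euc n))) : Prop :=
  SemiEutacticMaps {Q | ∃ S ∈ X, IsSimplexMap S Q}

/-- The simplex `-S`. -/
def negSimplex {n : ℕ} (S : Finset (Euc n)) : Finset (Euc n) :=
  S.map (Equiv.neg (Euc n)).toEmbedding

/-- `X` stays semi-eutactic after removing any pair `S, -S`. -/
def RedundantlySemiEutactic {n : ℕ} (X : Set (Finset (Euc n))) : Prop :=
  ∀ S ∈ X, SemiEutactic (X \ {S, negSimplex S})

end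

end BallCovering

/-!
Write `P₀` for the Voronoi polytope of the critical lattice `L₀`. Its points of norm one are
vertices, and the maximal simplices are exactly their classes modulo `L₀`
(`IsCriticalLattice.mem_maximalSimplices_iff`). The whole proof compares `L₀` with lattices `T L₀`
for `T` close to the identity.

*Extensible implies redundantly semi-eutactic.* Suppose that the maximal simplices other than
`±S₀` are not semi-eutactic. By separation of convex sets there is a matrix `A` with `tr A > 0`
whose quadratic form has negative mean on each of these simplices, where the mean is taken with
weights for which the vertices have barycentre `0`
(`exists_sum_eq_id_or_exists_functional`, `exists_quadratic_form`). The lattice `(1 + t A) L₀` with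
small `t > 0` has larger determinant. Since `0` is interior to every maximal simplex, the translation
by which the simplex can escape from the ball is of order `t`, so its contribution is of second
order, and in every small translate of the deformed simplex some vertex stays in the ball
(`eventually_exists_norm_le_one`). The unit ball thus still
covers everything except small neighbourhoods of the vertices of `±S₀`. A larger symmetric body
contains balls around some antipodal pair of unit vectors, and a rotation brings a vertex of `S₀`
there (`IsCriticalLattice.inextensible`). Neither genericity nor uniqueness plays a role.

*Redundantly semi-eutactic implies extensible.* If the ball were inextensible, there would be
covering lattices of determinant larger than that of `L₀` for the ball with arbitrarily small caps at
`±e`. A selection theorem (`exists_tendsto_latticeImage`), proved with an ultrafilter, shows that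
they converge to a critical lattice, which is `L₀` up to a rotation; so one of them is `T L₀` up to a
rotation, with `T` close to the identity. Only one pair `±S₀` of simplices can have vertices at the
caps. For every other maximal simplex `S` the points `T x`, `x ∈ S`, lie on a sphere around some
point `z`, and the covering property bounds the radius by `1`. If `α` are the barycentric
coordinates of `0`, then `tr (Tᵀ T Q_S) = ∑ α_x ‖T x‖² = R² - ‖z‖² ≤ 1` (`gramPairing_le`). A relation
`Id = ∑ υ_S Q_S` over these simplices gives `tr (Tᵀ T) ≤ n`, hence `|det T| ≤ 1`, a contradiction.

Genericity enters only through the fact that the points `T x`, `x ∈ S`, stay on a sphere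
(`Generic.eventually_exists_center`). An isomorphism of face lattices preserves the number of
vertices. Every vertex of `P₀` persists under small perturbations, so that the vertices of the
perturbed polytope correspond bijectively to those of `P₀`. If a class of vertices split into several
classes, then, by connectedness of a small ball, two perturbed cells belonging to different classes
would meet; their common face would contain corresponding vertices of both, so that the two classes
would agree.
-/

namespace BallCovering

open Set Module MeasureTheory Filter

/-! ### Lattices, bases and determinants -/

section Lattices

variable {n : ℕ} {L : Submodule ℤ (Euc n)}

theorem IsLattice.exists_basis (hL : IsLattice L) :
    ∃ b : Basis (Fin n) ℝ (Euc n), L = Submodule.span ℤ (range b) := by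
  obtain ⟨_, _⟩ := hL
  have : Module.Finite ℤ L := ZLattice.module_finite ℝ L
  have : Module.Free ℤ L := ZLattice.module_free ℝ L
  have hr : finrank ℤ L = n := by
    rw [ZLattice.rank ℝ L]; simp
  let b : Basis (Fin n) ℤ L := finBasisOfFinrankEq ℤ L hr
  exact ⟨b.ofZLatticeBasis ℝ L, (b.ofZLatticeBasis_span ℝ).symm⟩

theorem isLattice_span (b : Basis (Fin n) ℝ (Euc n)) :
    IsLattice (Submodule.span ℤ (range b)) :=
  ⟨inferInstance, inferInstance⟩

theorem latticeImage_span (T : Euc n →ₗ[ℝ] Euc n) (v : Fin n → Euc n) :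
    latticeImage T (Submodule.span ℤ (range v)) = Submodule.span ℤ (range (T ∘ v)) := by
  rw [latticeImage, Submodule.map_span, range_comp]
  rfl

theorem mem_latticeImage {T : Euc n →ₗ[ℝ] Euc n} {x : Euc n} :
    x ∈ latticeImage T L ↔ ∃ l ∈ L, T l = x := Iff.rfl

theorem exists_basis_comp {T : Euc n →ₗ[ℝ] Euc n} (hT : LinearMap.det T ≠ 0)
    (b : Basis (Fin n) ℝ (Euc n)) : ∃ b' : Basis (Fin n) ℝ (Euc n), ⇑b' = T ∘ b :=
  ⟨b.map (LinearEquiv.ofIsUnitDet (v := b) (v' := b)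
    (by rw [LinearMap.det_toMatrix]; exact hT.isUnit)), by ext; simp⟩

theorem IsLattice.image (hL : IsLattice L) {T : Euc n →ₗ[ℝ] Euc n}
    (hT : LinearMap.det T ≠ 0) : IsLattice (latticeImage T L) := by
  obtain ⟨b, rfl⟩ := hL.exists_basis
  obtain ⟨b', hb'⟩ := exists_basis_comp hT b
  rw [latticeImage_span, ← hb']
  exact isLattice_span b'

theorem covolume_span (b b₀ : Basis (Fin n) ℝ (Euc n)) :
    ZLattice.covolume (Submodule.span ℤ (range b)) =
      |b₀.det b| * volume.real (ZSpan.fundamentalDomain b₀) := by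
  rw [ZLattice.covolume_eq_measure_fundamentalDomain _ _ (ZSpan.isAddFundamentalDomain b volume),
    ZSpan.measureReal_fundamentalDomain b volume b₀]

theorem covolume_latticeImage (hL : IsLattice L) {T : Euc n →ₗ[ℝ] Euc n}
    (hT : LinearMap.det T ≠ 0) :
    ZLattice.covolume (latticeImage T L) = |LinearMap.det T| * ZLattice.covolume L := by
  obtain ⟨b, rfl⟩ := hL.exists_basis
  obtain ⟨b', hb'⟩ := exists_basis_comp hT b
  rw [latticeImage_span, ← hb', covolume_span b' b, covolume_span b b, hb', Basis.det_comp,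
    abs_mul, mul_assoc]

theorem IsLattice.covolume_pos (hL : IsLattice L) : 0 < ZLattice.covolume L := by
  obtain ⟨_, _⟩ := hL
  exact ZLattice.covolume_pos L

theorem IsLattice.finite_norm_le (hL : IsLattice L) (r : ℝ) : {l ∈ L | ‖l‖ ≤ r}.Finite := by
  obtain ⟨b, rfl⟩ := hL.exists_basis
  refine (ZSpan.setFinite_inter b (s := Metric.closedBall 0 r) Metric.isBounded_closedBall).subset ?_
  rintro l ⟨h1, h2⟩
  exact ⟨by simpa using h2, h1⟩

theorem IsLattice.finite_norm_sub_le (hL : IsLattice L) (x : Euc n) (r : ℝ) :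
    {l ∈ L | ‖x - l‖ ≤ r}.Finite := by
  refine (hL.finite_norm_le (r + ‖x‖)).subset ?_
  rintro l ⟨h1, h2⟩
  refine ⟨h1, ?_⟩
  have := norm_sub_le x (x - l)
  rw [sub_sub_cancel] at this
  linarith

theorem IsLattice.exists_le_norm (hL : IsLattice L) :
    ∃ m > 0, ∀ l ∈ L, l ≠ 0 → m ≤ ‖l‖ := by
  have hf : ({l ∈ L | ‖l‖ ≤ 1} \ {0}).Finite := (hL.finite_norm_le 1).sdiff
  rcases ({l ∈ L | ‖l‖ ≤ 1} \ {0}).eq_empty_or_nonempty with he | hne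
  · refine ⟨1, one_pos, fun l hl h0 => ?_⟩
    by_contra! h
    have : l ∈ ({l ∈ L | ‖l‖ ≤ 1} \ {0} : Set (Euc n)) := ⟨⟨hl, h.le⟩, h0⟩
    rw [he] at this
    exact this
  · obtain ⟨a, ha, hmin⟩ := hf.exists_minimalFor (fun l => ‖l‖) _ hne
    refine ⟨‖a‖, norm_pos_iff.2 ha.2, fun l hl h0 => ?_⟩
    rcases le_total ‖l‖ 1 with h | h
    · by_contra! h'
      exact absurd (hmin ⟨⟨hl, h⟩, h0⟩ h'.le) (not_le.2 h')
    · exact ha.1.2.trans h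

/-- Every translate of a point has a representative in the Voronoi polytope. -/
theorem IsLattice.exists_sub_mem_voronoiPolytope (hL : IsLattice L) (x : Euc n) :
    ∃ l ∈ L, x - l ∈ voronoiPolytope L := by
  have hf := hL.finite_norm_sub_le x ‖x‖
  obtain ⟨a, ha, hmin⟩ := hf.exists_minimalFor (fun l => ‖x - l‖) _ ⟨0, L.zero_mem, by simp⟩
  refine ⟨a, ha.1, fun l hl => ?_⟩
  rw [sub_sub]
  by_contra! h
  exact absurd (hmin ⟨L.add_mem ha.1 hl, (h.le.trans ha.2)⟩ h.le) (not_le.2 h)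

/-- A set that meets every translate of a lattice in at least `N` points has volume at least
`N` times the covolume. -/
theorem IsLattice.mul_covolume_le (hL : IsLattice L) {K : Set (Euc n)} (hK : IsCompact K) {N : ℕ}
    (h : ∀ x : Euc n, ∃ s : Finset (Euc n), N ≤ s.card ∧ ∀ l ∈ s, l ∈ L ∧ x + l ∈ K) :
    N * ZLattice.covolume L ≤ volume.real K := by
  obtain ⟨_, _⟩ := hL
  have : Module.Finite ℤ L := ZLattice.module_finite ℝ L
  have : Module.Free ℤ L := ZLattice.module_free ℝ L
  have : MeasurableVAdd L (Euc n) := (inferInstance : MeasurableVAdd L.toAddSubgroup (Euc n))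
  have : VAddInvariantMeasure L (Euc n) volume :=
    (inferInstance : VAddInvariantMeasure L.toAddSubgroup (Euc n) volume)
  have : Countable L := inferInstance
  set F := ZSpan.fundamentalDomain ((Free.chooseBasis ℤ L).ofZLatticeBasis ℝ) with hF
  have hfund : IsAddFundamentalDomain L F (volume : Measure (Euc n)) :=
    ZLattice.isAddFundamentalDomain (Free.chooseBasis ℤ L) volume
  rw [ZLattice.covolume_eq_measure_fundamentalDomain L volume hfund]
  have hKm : MeasurableSet K := hK.measurableSet
  have hmeas : ∀ l : L, Measurable fun x : Euc n => K.indicator (1 : Euc n → ENNReal) (l +ᵥ x) :=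
    fun l => (measurable_one.indicator hKm).comp (measurable_const_vadd l)
  have key : (N : ENNReal) * volume F ≤ volume K := by
    calc (N : ENNReal) * volume F = ∫⁻ _ in F, (N : ENNReal) := by simp
      _ ≤ ∫⁻ x in F, ∑' l : L, K.indicator (1 : Euc n → ENNReal) (l +ᵥ x) := by
        refine lintegral_mono fun x => ?_
        obtain ⟨s, hs, hsK⟩ := h x
        let t : Finset L := s.attach.map
          ⟨fun l => ⟨l.1, (hsK l.1 l.2).1⟩, fun a b hab => Subtype.ext (by simpa using hab)⟩
        calc (N : ENNReal) ≤ (s.card : ENNReal) := by exact_mod_cast hs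
          _ = ∑ l ∈ t, K.indicator (1 : Euc n → ENNReal) (l +ᵥ x) := by
            rw [Finset.sum_map]
            rw [Finset.sum_congr rfl (g := fun _ => (1 : ENNReal))]
            · simp
            · rintro l -
              refine (indicator_of_mem ?_ _).trans rfl
              have := (hsK l.1 l.2).2
              rw [add_comm] at this
              exact this
          _ ≤ _ := ENNReal.sum_le_tsum t
      _ = ∑' l : L, ∫⁻ x in F, K.indicator (1 : Euc n → ENNReal) (l +ᵥ x) :=
        lintegral_tsum fun l => (hmeas l).aemeasurable
      _ = ∫⁻ x, K.indicator (1 : Euc n → ENNReal) x := (hfund.lintegral_eq_tsum'' _).symm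
      _ = volume K := by rw [lintegral_indicator_one hKm]
  have := ENNReal.toReal_mono hK.measure_lt_top.ne key
  simpa [Measure.real] using this

theorem IsCoveringLattice.covolume_le {K : Set (Euc n)} (hL : IsCoveringLattice K L)
    (hK : IsCompact K) : ZLattice.covolume L ≤ volume.real K := by
  have := hL.1.mul_covolume_le hK (N := 1) fun x => by
    obtain ⟨l, hl, hx⟩ := hL.2 x
    exact ⟨{-l}, by simp, by simpa [sub_eq_add_neg] using ⟨hl, hx⟩⟩
  simpa using this

theorem IsCoveringLattice.covolume_le_criticalDet {K : Set (Euc n)} (hL : IsCoveringLattice K L)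
    (hK : IsCompact K) : ZLattice.covolume L ≤ criticalDet K := by
  refine le_csSup ⟨volume.real K, ?_⟩ ⟨L, hL, rfl⟩
  rintro d ⟨L', hL', rfl⟩
  exact hL'.covolume_le hK

/-- A lattice with a short nonzero vector covers the larger ball many times, so its covolume is
small. -/
theorem IsCoveringLattice.covolume_le_norm_mul {r : ℝ}
    (hL : IsCoveringLattice (Metric.closedBall 0 r) L) {v : Euc n} (hv : v ∈ L) (hv0 : v ≠ 0) :
    ZLattice.covolume L ≤ ‖v‖ * volume.real (Metric.closedBall (0 : Euc n) (r + 1)) := by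
  have hvpos : 0 < ‖v‖ := norm_pos_iff.2 hv0
  set N := ⌊1 / ‖v‖⌋₊ + 1 with hN
  have h1 : N * ZLattice.covolume L ≤ volume.real (Metric.closedBall (0 : Euc n) (r + 1)) := by
    refine hL.1.mul_covolume_le (isCompact_closedBall _ _) fun x => ?_
    obtain ⟨l, hl, hx⟩ := hL.2 x
    have hz : ∀ j : ℕ, ((j : ℤ) • v : Euc n) = (j : ℝ) • v := fun j => by
      rw [natCast_zsmul, Nat.cast_smul_eq_nsmul]
    have hinj : Function.Injective fun j : ℕ => (j : ℤ) • v - l := by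
      intro i j hij
      have : (i : ℤ) • v = (j : ℤ) • v := sub_left_injective hij
      rw [hz, hz] at this
      exact_mod_cast smul_left_injective ℝ hv0 this
    refine ⟨(Finset.range N).map ⟨_, hinj⟩, by simp, ?_⟩
    intro y hy
    simp only [Finset.mem_map, Finset.mem_range, Function.Embedding.coeFn_mk] at hy
    obtain ⟨j, hj, rfl⟩ := hy
    refine ⟨L.sub_mem (L.smul_mem _ hv) hl, ?_⟩
    have hj' : (j : ℝ) * ‖v‖ ≤ 1 := by
      have h2 : (j : ℝ) ≤ 1 / ‖v‖ :=
        (Nat.cast_le.2 (Nat.lt_succ_iff.1 hj)).trans (Nat.floor_le (by positivity))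
      rwa [le_div_iff₀ hvpos] at h2
    have hx' : ‖x - l‖ ≤ r := by simpa using hx
    rw [mem_closedBall_zero_iff]
    calc ‖x + ((j : ℤ) • v - l)‖ = ‖(x - l) + (j : ℤ) • v‖ := by congr 1; abel
      _ ≤ ‖x - l‖ + ‖(j : ℤ) • v‖ := norm_add_le _ _
      _ = ‖x - l‖ + j * ‖v‖ := by rw [hz]; simp [norm_smul]
      _ ≤ r + 1 := by linarith
  have h2 : 1 / ‖v‖ ≤ N := by
    rw [hN]; push_cast; exact (Nat.lt_floor_add_one _).le
  have h3 := mul_le_mul_of_nonneg_right h2 hL.1.covolume_pos.le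
  have h4 := h3.trans h1
  rwa [div_mul_eq_mul_div, one_mul, div_le_iff₀ hvpos, mul_comm] at h4

end Lattices

/-! ### The Voronoi polytope and its vertices -/

section Voronoi

variable {n : ℕ} {L : Submodule ℤ (Euc n)}

local notation "⟪" x ", " y "⟫" => inner ℝ x y

theorem norm_le_norm_sub_iff (x l : Euc n) : ‖x‖ ≤ ‖x - l‖ ↔ 2 * ⟪x, l⟫ ≤ ‖l‖ ^ 2 := by
  rw [← sq_le_sq₀ (norm_nonneg _) (norm_nonneg _), norm_sub_sq_real]
  constructor <;> intro h <;> linarith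

theorem norm_sub_eq_norm_iff (x l : Euc n) : ‖x - l‖ = ‖x‖ ↔ 2 * ⟪x, l⟫ = ‖l‖ ^ 2 := by
  rw [← sq_eq_sq₀ (norm_nonneg _) (norm_nonneg _), norm_sub_sq_real]
  constructor <;> intro h <;> linarith

theorem mem_voronoiPolytope_iff {x : Euc n} :
    x ∈ voronoiPolytope L ↔ ∀ l ∈ L, 2 * ⟪x, l⟫ ≤ ‖l‖ ^ 2 :=
  forall₂_congr fun l _ => norm_le_norm_sub_iff x l

theorem zero_mem_voronoiPolytope : (0 : Euc n) ∈ voronoiPolytope L := fun l _ => by simp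

theorem convex_voronoiPolytope : Convex ℝ (voronoiPolytope L) := by
  intro x hx y hy a b ha hb hab
  rw [mem_voronoiPolytope_iff] at *
  intro l hl
  rw [inner_add_left, real_inner_smul_left, real_inner_smul_left]
  have h1 := mul_le_mul_of_nonneg_left (hx l hl) ha
  have h2 := mul_le_mul_of_nonneg_left (hy l hl) hb
  have h3 : ‖l‖ ^ 2 = a * ‖l‖ ^ 2 + b * ‖l‖ ^ 2 := by rw [← add_mul, hab, one_mul]
  linarith

theorem neg_mem_voronoiPolytope {x : Euc n} (hx : x ∈ voronoiPolytope L) :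
    -x ∈ voronoiPolytope L := fun l hl => by
  have := hx (-l) (L.neg_mem hl)
  rw [← norm_neg (-x - l)]
  simpa [add_comm] using this

theorem isClosed_voronoiPolytope : IsClosed (voronoiPolytope L) := by
  have : voronoiPolytope L = ⋂ l ∈ L, {x | ‖x‖ ≤ ‖x - l‖} := by
    ext x; simp [voronoiPolytope]
  rw [this]
  exact isClosed_biInter fun l _ => isClosed_le (by fun_prop) (by fun_prop)

theorem IsLattice.exists_covering_radius (hL : IsLattice L) :
    ∃ R : ℝ, ∀ x : Euc n, ∃ l ∈ L, ‖x - l‖ ≤ R := by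
  obtain ⟨b, rfl⟩ := hL.exists_basis
  exact ⟨∑ i, ‖b i‖, fun x => ⟨ZSpan.floor b x, (ZSpan.floor b x).2, ZSpan.norm_fract_le b x⟩⟩

theorem IsLattice.isCompact_voronoiPolytope (hL : IsLattice L) :
    IsCompact (voronoiPolytope L) := by
  obtain ⟨R, hR⟩ := hL.exists_covering_radius
  refine (isCompact_closedBall (0 : Euc n) R).of_isClosed_subset isClosed_voronoiPolytope ?_
  intro x hx
  obtain ⟨l, hl, h⟩ := hR x
  exact mem_closedBall_zero_iff.2 ((hx l hl).trans h)

theorem norm_sub_eq_of_mem {x l : Euc n} (hx : x ∈ voronoiPolytope L) (hl : l ∈ L)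
    (hxl : x - l ∈ voronoiPolytope L) : ‖x - l‖ = ‖x‖ :=
  le_antisymm (by simpa using hxl (-l) (L.neg_mem hl)) (hx l hl)

theorem sub_mem_voronoiPolytope {x l : Euc n} (hx : x ∈ voronoiPolytope L) (hl : l ∈ L)
    (h : ‖x - l‖ = ‖x‖) : x - l ∈ voronoiPolytope L := fun l' hl' => by
  rw [h, sub_sub]
  exact hx _ (L.add_mem hl hl')

/-- The distances from a point to the lattice points have a gap above any given value. -/
theorem IsLattice.exists_gap (hL : IsLattice L) (x : Euc n) (r : ℝ) :
    ∃ g > 0, ∀ l ∈ L, ‖x - l‖ < r + g → ‖x - l‖ ≤ r := by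
  have hf : ({l ∈ L | ‖x - l‖ ≤ r + 1} ∩ {l | r < ‖x - l‖}).Finite :=
    (hL.finite_norm_sub_le x (r + 1)).inter_of_left _
  rcases ({l ∈ L | ‖x - l‖ ≤ r + 1} ∩ {l | r < ‖x - l‖}).eq_empty_or_nonempty with he | hne
  · refine ⟨1, one_pos, fun l hl h => ?_⟩
    by_contra! h'
    have : l ∈ ({l ∈ L | ‖x - l‖ ≤ r + 1} ∩ {l | r < ‖x - l‖}) := ⟨⟨hl, h.le⟩, h'⟩
    rw [he] at this
    exact this
  · obtain ⟨a, ha, hmin⟩ := hf.exists_minimalFor (fun l => ‖x - l‖) _ hne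
    have ha2 : r < ‖x - a‖ := ha.2
    refine ⟨‖x - a‖ - r, sub_pos.2 ha2, fun l hl h => ?_⟩
    by_contra! h'
    rw [add_sub_cancel] at h
    exact absurd (hmin ⟨⟨hl, h.le.trans ha.1.2⟩, h'⟩ h.le) (not_le.2 h)

/-- Near a point of the Voronoi polytope, only the constraints active at this point matter. -/
theorem IsLattice.exists_local_voronoiPolytope (hL : IsLattice L) {x : Euc n} :
    ∃ s > 0, ∀ y : Euc n, ‖y - x‖ < s →
      (∀ l ∈ L, ‖x - l‖ ≤ ‖x‖ → ‖y‖ ≤ ‖y - l‖) → y ∈ voronoiPolytope L := by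
  obtain ⟨g, hg, h⟩ := hL.exists_gap x ‖x‖
  refine ⟨g / 2, by positivity, fun y hy hact l hl => ?_⟩
  by_cases hc : ‖x - l‖ < ‖x‖ + g
  · exact hact l hl (h l hl hc)
  · have h1 : ‖x - l‖ ≤ ‖y - l‖ + ‖y - x‖ := by
      have := norm_sub_le (y - l) (y - x)
      rwa [show y - l - (y - x) = x - l by abel] at this
    have h2 : ‖y‖ ≤ ‖x‖ + ‖y - x‖ := by
      have := norm_add_le x (y - x)
      rwa [add_sub_cancel] at this
    linarith

/-- A point of the Voronoi polytope is a vertex when the constraints active there span. -/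
theorem IsLattice.mem_voronoiVertices_iff (hL : IsLattice L) {x : Euc n} :
    x ∈ voronoiVertices L ↔ x ∈ voronoiPolytope L ∧
      ∀ c : Euc n, (∀ l ∈ L, ‖x - l‖ = ‖x‖ → ⟪c, l⟫ = 0) → c = 0 := by
  constructor
  · rintro ⟨hx, hext⟩
    refine ⟨hx, fun c hc => ?_⟩
    obtain ⟨s, hs, h⟩ := hL.exists_local_voronoiPolytope (x := x)
    by_contra hc0
    have hcp : 0 < ‖c‖ := norm_pos_iff.2 hc0
    set t := s / (2 * ‖c‖) with ht
    have htp : 0 < t := by positivity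
    have hmem : ∀ a : ℝ, |a| = t → x + a • c ∈ voronoiPolytope L := by
      intro a ha
      refine h _ ?_ ?_
      · rw [add_sub_cancel_left, norm_smul, Real.norm_eq_abs, ha, ht]
        field_simp
        linarith
      · intro l hl hle
        have heq : ‖x - l‖ = ‖x‖ := le_antisymm hle (hx l hl)
        rw [norm_le_norm_sub_iff, inner_add_left, real_inner_smul_left, hc l hl heq]
        rw [norm_sub_eq_norm_iff] at heq
        linarith
    have h1 := hmem t (abs_of_pos htp)
    have h2 := hmem (-t) (by rw [abs_neg, abs_of_pos htp])
    have := hext h1 h2 ⟨1/2, 1/2, by norm_num, by norm_num, by norm_num, by module⟩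
    rw [add_eq_left, smul_eq_zero] at this
    exact this.elim htp.ne' hc0
  · rintro ⟨hx, h⟩
    refine ⟨hx, fun y hy z hz ⟨a, b, ha, hb, hab, hxyz⟩ => ?_⟩
    rw [← sub_eq_zero]
    refine h _ fun l hl hact => ?_
    rw [norm_sub_eq_norm_iff] at hact
    rw [mem_voronoiPolytope_iff] at hy hz
    have h1 := hy l hl
    have h2 := hz l hl
    have h3 : ⟪x, l⟫ = a * ⟪y, l⟫ + b * ⟪z, l⟫ := by
      rw [← hxyz, inner_add_left, real_inner_smul_left, real_inner_smul_left]
    rw [inner_sub_left]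
    have h4 : 2 * ⟪y, l⟫ = ‖l‖ ^ 2 := by
      have hb' : b = 1 - a := by linarith
      subst hb'
      have : a * (‖l‖ ^ 2 - 2 * ⟪y, l⟫) + (1 - a) * (‖l‖ ^ 2 - 2 * ⟪z, l⟫) = 0 := by
        linear_combination 2 * h3 - hact
      have h5 : 0 ≤ (1 - a) * (‖l‖ ^ 2 - 2 * ⟪z, l⟫) := mul_nonneg hb.le (by linarith)
      have h6 : 0 ≤ a * (‖l‖ ^ 2 - 2 * ⟪y, l⟫) := mul_nonneg ha.le (by linarith)
      have h7 : a * (‖l‖ ^ 2 - 2 * ⟪y, l⟫) = 0 := by linarith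
      rcases mul_eq_zero.1 h7 with h8 | h8
      · exact absurd h8 ha.ne'
      · linarith
    linarith

theorem voronoiVertices_subset : voronoiVertices L ⊆ voronoiPolytope L := extremePoints_subset

theorem IsLattice.eq_of_active (hL : IsLattice L) {x y : Euc n} (hx : x ∈ voronoiVertices L)
    (h : ∀ l ∈ L, ‖x - l‖ = ‖x‖ → ‖y - l‖ = ‖y‖) : y = x := by
  rw [← sub_eq_zero]
  refine (hL.mem_voronoiVertices_iff.1 hx).2 _ fun l hl hact => ?_
  have h1 := (norm_sub_eq_norm_iff _ _).1 hact
  have h2 := (norm_sub_eq_norm_iff _ _).1 (h l hl hact)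
  rw [inner_sub_left]
  linarith

theorem IsLattice.sub_mem_voronoiVertices (hL : IsLattice L) {x l : Euc n}
    (hx : x ∈ voronoiVertices L) (hl : l ∈ L) (h : ‖x - l‖ = ‖x‖) :
    x - l ∈ voronoiVertices L := by
  rw [hL.mem_voronoiVertices_iff] at hx ⊢
  refine ⟨sub_mem_voronoiPolytope hx.1 hl h, fun c hc => hx.2 c fun l' hl' h' => ?_⟩
  have h1 := hc (l' - l) (L.sub_mem hl' hl) (by rw [sub_sub_sub_cancel_right, h, h'])
  have h2 := hc (-l) (L.neg_mem hl) (by rw [sub_neg_eq_add, sub_add_cancel, h])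
  rw [inner_sub_right] at h1
  rw [inner_neg_right] at h2
  linarith

theorem IsLattice.finite_active (hL : IsLattice L) (x : Euc n) :
    {l ∈ L | ‖x - l‖ = ‖x‖}.Finite :=
  (hL.finite_norm_sub_le x ‖x‖).subset fun _ h => ⟨h.1, h.2.le⟩

theorem IsLattice.finite_voronoiVertices (hL : IsLattice L) : (voronoiVertices L).Finite := by
  obtain ⟨R, hR⟩ := hL.isCompact_voronoiPolytope.isBounded.exists_norm_le
  refine Set.Finite.of_finite_image (f := fun x => {l ∈ L | ‖x - l‖ = ‖x‖}) ?_ ?_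
  · refine (hL.finite_norm_le (2 * R)).finite_subsets.subset ?_
    rintro _ ⟨x, hx, rfl⟩ l ⟨hl, hxl⟩
    refine ⟨hl, ?_⟩
    have h1 := norm_sub_le x (x - l)
    rw [sub_sub_cancel, hxl] at h1
    linarith [hR x (voronoiVertices_subset hx)]
  · intro x hx y hy hxy
    refine (hL.eq_of_active hx fun l hl h => ?_).symm
    have : l ∈ {l ∈ L | ‖x - l‖ = ‖x‖} := ⟨hl, h⟩
    simp only at hxy
    rw [hxy] at this
    exact this.2

/-- The vertices of the Voronoi polytope are exposed: the sum of the active constraints is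
maximal only there. -/
theorem IsLattice.isExposed_singleton (hL : IsLattice L) {x : Euc n}
    (hx : x ∈ voronoiVertices L) : IsExposed ℝ (voronoiPolytope L) {x} := by
  intro _
  have hxP := voronoiVertices_subset hx
  set A := (hL.finite_active x).toFinset with hA
  have hAmem : ∀ l, l ∈ A ↔ l ∈ L ∧ ‖x - l‖ = ‖x‖ := fun l => by simp [hA]
  have hle : ∀ y ∈ voronoiPolytope L, ∀ l ∈ A, ⟪l, y⟫ ≤ ⟪l, x⟫ := by
    intro y hy l hl
    obtain ⟨h1, h2⟩ := (hAmem l).1 hl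
    have h3 := mem_voronoiPolytope_iff.1 hy l h1
    rw [norm_sub_eq_norm_iff] at h2
    rw [real_inner_comm l y] at h3
    rw [real_inner_comm l x] at h2
    linarith
  refine ⟨∑ l ∈ A, innerSL ℝ l, Subset.antisymm ?_ ?_⟩
  · rintro _ rfl
    refine ⟨hxP, fun y hy => ?_⟩
    simp only [sum_apply, innerSL_apply_apply]
    exact Finset.sum_le_sum (hle y hy)
  · rintro y ⟨hy, hmax⟩
    have h1 := hmax x hxP
    simp only [sum_apply, innerSL_apply_apply] at h1
    have h2 := (Finset.sum_eq_sum_iff_of_le (hle y hy)).1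
      (le_antisymm (Finset.sum_le_sum (hle y hy)) h1)
    refine hL.eq_of_active hx fun l hl hact => ?_
    have h3 := h2 l ((hAmem l).2 ⟨hl, hact⟩)
    rw [norm_sub_eq_norm_iff] at hact ⊢
    rw [real_inner_comm, h3, real_inner_comm, hact]

end Voronoi

section FaceLattice

variable {n : ℕ}

/-- The empty face is the least element of the face lattice. -/
instance faceLatticeOrderBot (P : Set (Euc n)) : OrderBot (FaceLattice P) where
  bot := ⟨∅, isExposed_empty⟩
  bot_le F := Set.empty_subset F.1

theorem IsLattice.isAtom_iff {L : Submodule ℤ (Euc n)} (hL : IsLattice L)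
    {F : FaceLattice (voronoiPolytope L)} :
    IsAtom F ↔ ∃ x ∈ voronoiVertices L, F.1 = {x} := by
  constructor
  · intro hF
    have hne : F.1.Nonempty := by
      rw [nonempty_iff_ne_empty]
      exact fun h => hF.1 (Subtype.ext h)
    obtain ⟨x, hx⟩ := (F.2.isCompact hL.isCompact_voronoiPolytope).extremePoints_nonempty hne
    have hxV : x ∈ voronoiVertices L := F.2.isExtreme.extremePoints_subset_extremePoints hx
    refine ⟨x, hxV, ?_⟩
    have hle : (⟨{x}, hL.isExposed_singleton hxV⟩ : FaceLattice (voronoiPolytope L)) ≤ F :=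
      singleton_subset_iff.2 hx.1
    rcases hF.le_iff.1 hle with h | h
    · exact absurd (congrArg Subtype.val h) (singleton_ne_empty x)
    · exact (congrArg Subtype.val h).symm
  · rintro ⟨x, hx, hF⟩
    refine ⟨fun h => ?_, fun G hG => ?_⟩
    · rw [h] at hF
      exact (singleton_ne_empty x) hF.symm
    · have hsub : G.1 ⊆ {x} := hF ▸ hG.le
      rcases subset_singleton_iff_eq.1 hsub with h | h
      · exact Subtype.ext h
      · exact absurd (Subtype.ext (h.trans hF.symm)) hG.ne

theorem IsLattice.ncard_setOf_isAtom {L : Submodule ℤ (Euc n)} (hL : IsLattice L) :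
    {F : FaceLattice (voronoiPolytope L) | IsAtom F}.ncard = (voronoiVertices L).ncard := by
  symm
  refine Set.ncard_congr (fun x hx => ⟨{x}, hL.isExposed_singleton hx⟩) ?_ ?_ ?_
  · exact fun x hx => hL.isAtom_iff.2 ⟨x, hx, rfl⟩
  · intro x y hx hy h
    exact singleton_injective (congrArg Subtype.val h)
  · intro F hF
    obtain ⟨x, hx, h⟩ := hL.isAtom_iff.1 hF
    exact ⟨x, hx, Subtype.ext h.symm⟩

/-- The number of vertices is an invariant of the combinatorial type. -/
theorem SameCombinatorialType.ncard_voronoiVertices_eq {L L' : Submodule ℤ (Euc n)}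
    (h : SameCombinatorialType (voronoiPolytope L) (voronoiPolytope L'))
    (hL : IsLattice L) (hL' : IsLattice L') :
    (voronoiVertices L).ncard = (voronoiVertices L').ncard := by
  obtain ⟨e⟩ := h
  rw [← hL.ncard_setOf_isAtom, ← hL'.ncard_setOf_isAtom]
  refine Set.ncard_congr (fun F _ => e F) ?_ ?_ ?_
  · exact fun F hF => (e.isAtom_iff F).2 hF
  · exact fun F G _ _ h => e.injective h
  · exact fun F hF => ⟨e.symm F, (e.symm.isAtom_iff F).2 hF, e.apply_symm_apply F⟩

end FaceLattice

/-! ### Maximal simplices of a critical lattice -/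

section Maximal

variable {n : ℕ} {L : Submodule ℤ (Euc n)}

local notation "⟪" x ", " y "⟫" => inner ℝ x y

/-- The active constraints at a vertex span the space, so that `0` is the only centre of a sphere
through its class. -/
theorem IsLattice.circumradius_eq (hL : IsLattice L) {x : Euc n} (hx : x ∈ voronoiVertices L)
    {S : Finset (Euc n)} (hS : (S : Set (Euc n)) = {y | y ∈ voronoiVertices L ∧ y - x ∈ L}) :
    circumradius S = ‖x‖ := by
  have hmem : ∀ y, y ∈ S ↔ y ∈ voronoiVertices L ∧ y - x ∈ L := fun y => by
    rw [← Finset.mem_coe, hS]; rfl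
  have hnorm : ∀ y ∈ S, ‖y‖ = ‖x‖ := by
    intro y hy
    obtain ⟨h1, h2⟩ := (hmem y).1 hy
    have h3 := norm_sub_eq_of_mem (voronoiVertices_subset hx) (l := x - y)
      (by simpa using L.neg_mem h2) (by simpa using voronoiVertices_subset h1)
    simpa using h3
  have : {r : ℝ | 0 ≤ r ∧ ∃ c : Euc n, ∀ y ∈ S, dist y c = r} = {‖x‖} := by
    refine Subset.antisymm ?_ ?_
    · rintro r ⟨-, c, hc⟩
      have hxS : x ∈ S := (hmem x).2 ⟨hx, by simp⟩
      have hc0 : c = 0 := by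
        refine (hL.mem_voronoiVertices_iff.1 hx).2 c fun l hl hact => ?_
        have hlS : x - l ∈ S :=
          (hmem _).2 ⟨hL.sub_mem_voronoiVertices hx hl hact, by simpa using hl⟩
        have h1 : ‖(x - c) - l‖ = ‖x - c‖ := by
          have := (hc _ hlS).trans (hc _ hxS).symm
          rwa [dist_eq_norm, dist_eq_norm, sub_right_comm] at this
        rw [norm_sub_eq_norm_iff] at h1 hact
        rw [inner_sub_left] at h1
        linarith
      rw [mem_singleton_iff, ← hc x hxS, hc0, dist_zero_right]
    · rintro _ rfl
      exact ⟨norm_nonneg _, 0, fun y hy => by rw [dist_zero_right, hnorm y hy]⟩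
  rw [circumradius, this, csInf_singleton]

theorem isCompact_unitBall : IsCompact (unitBall n) := isCompact_closedBall _ _

theorem IsCoveringLattice.norm_le_one (hL : IsCoveringLattice (unitBall n) L) {x : Euc n}
    (hx : x ∈ voronoiPolytope L) : ‖x‖ ≤ 1 := by
  obtain ⟨l, hl, h⟩ := hL.2 x
  exact (hx l hl).trans (mem_closedBall_zero_iff.1 h)

/-- The Voronoi polytope of a critical lattice of the ball touches the unit sphere: otherwise the
lattice could be enlarged. -/
theorem IsCriticalLattice.exists_norm_eq_one (hn : 1 ≤ n)
    (hL : IsCriticalLattice (unitBall n) L) : ∃ x ∈ voronoiPolytope L, ‖x‖ = 1 := by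
  obtain ⟨x, hx, hmax⟩ := hL.1.1.isCompact_voronoiPolytope.exists_isMaxOn
    ⟨0, zero_mem_voronoiPolytope⟩ continuous_norm.continuousOn
  refine ⟨x, hx, le_antisymm (hL.1.norm_le_one hx) ?_⟩
  by_contra! hlt
  set s : ℝ := 2 / (1 + ‖x‖) with hs
  have hs1 : 1 < s := by rw [hs, lt_div_iff₀ (by positivity)]; linarith
  have hs0 : 0 < s := by linarith
  set T : Euc n →ₗ[ℝ] Euc n := s • LinearMap.id with hT
  have hdet : LinearMap.det T = s ^ n := by simp [hT]
  have hdet0 : LinearMap.det T ≠ 0 := by rw [hdet]; positivity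
  have hcov : IsCoveringLattice (unitBall n) (latticeImage T L) := by
    refine ⟨hL.1.1.image hdet0, fun y => ?_⟩
    obtain ⟨l, hl, hyl⟩ := hL.1.1.exists_sub_mem_voronoiPolytope (s⁻¹ • y)
    refine ⟨T l, ⟨l, hl, rfl⟩, ?_⟩
    have h1 : y - T l = s • (s⁻¹ • y - l) := by
      rw [smul_sub, smul_inv_smul₀ hs0.ne']; rfl
    have h2 : ‖s⁻¹ • y - l‖ ≤ ‖x‖ := hmax hyl
    rw [unitBall, mem_closedBall_zero_iff, h1, norm_smul, Real.norm_of_nonneg hs0.le]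
    calc s * ‖s⁻¹ • y - l‖ ≤ s * ‖x‖ := by gcongr
      _ ≤ 1 := by rw [hs, div_mul_eq_mul_div, div_le_one (by positivity)]; linarith
  have h1 := hcov.covolume_le_criticalDet isCompact_unitBall
  rw [covolume_latticeImage hL.1.1 hdet0, hdet, abs_of_pos (by positivity), ← hL.2] at h1
  have h2 : 1 < s ^ n := one_lt_pow₀ hs1 (by omega)
  nlinarith [hL.1.1.covolume_pos]

/-- A point of the Voronoi polytope on the unit sphere is a vertex, by strict convexity of the
ball. -/
theorem IsCoveringLattice.mem_voronoiVertices (hL : IsCoveringLattice (unitBall n) L) {x : Euc n}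
    (hx : x ∈ voronoiPolytope L) (h1 : ‖x‖ = 1) : x ∈ voronoiVertices L := by
  have hsub : voronoiPolytope L ⊆ Metric.closedBall 0 1 := fun y hy =>
    mem_closedBall_zero_iff.2 (hL.norm_le_one hy)
  refine inter_extremePoints_subset_extremePoints_of_subset hsub ⟨hx, ?_⟩
  exact StrictConvexSpace.sphere_subset_extremePoints_closedBall _ one_ne_zero (by simpa using h1)

/-- The points of the Voronoi polytope that are congruent to `x` modulo the lattice. -/
def voronoiClass (L : Submodule ℤ (Euc n)) (x : Euc n) : Set (Euc n) :=
  {y | y ∈ voronoiPolytope L ∧ y - x ∈ L}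

theorem norm_eq_of_mem_voronoiClass {x y : Euc n} (hx : x ∈ voronoiPolytope L)
    (hy : y ∈ voronoiClass L x) : ‖y‖ = ‖x‖ := by
  have h3 := norm_sub_eq_of_mem hx (l := x - y)
    (by simpa using L.neg_mem hy.2) (by simpa using hy.1)
  simpa using h3

theorem voronoiClass_eq_of_mem {x y : Euc n} (hy : y - x ∈ L) :
    voronoiClass L y = voronoiClass L x := by
  ext z
  refine and_congr_right fun _ => ⟨fun h => ?_, fun h => ?_⟩
  · simpa using L.add_mem h hy
  · simpa using L.sub_mem h hy

theorem IsLattice.voronoiClass_eq (hL : IsLattice L) {x : Euc n} (hx : x ∈ voronoiVertices L) :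
    voronoiClass L x = {y | y ∈ voronoiVertices L ∧ y - x ∈ L} := by
  ext y
  refine ⟨fun hy => ⟨?_, hy.2⟩, fun hy => ⟨voronoiVertices_subset hy.1, hy.2⟩⟩
  have h := norm_eq_of_mem_voronoiClass (voronoiVertices_subset hx) hy
  have := hL.sub_mem_voronoiVertices hx (l := x - y) (by simpa using L.neg_mem hy.2)
    (by simpa using h)
  simpa using this

theorem IsLattice.finite_voronoiClass (hL : IsLattice L) {x : Euc n}
    (hx : x ∈ voronoiPolytope L) : (voronoiClass L x).Finite := by
  refine ((hL.finite_active x).image (fun l => x - l)).subset fun y hy => ⟨x - y, ⟨?_, ?_⟩, ?_⟩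
  · simpa using L.neg_mem hy.2
  · simpa using norm_eq_of_mem_voronoiClass hx hy
  · simp

theorem IsCriticalLattice.mem_maximalSimplices_iff (hn : 1 ≤ n)
    (hL : IsCriticalLattice (unitBall n) L) {S : Finset (Euc n)} :
    S ∈ maximalSimplices L ↔
      ∃ x ∈ voronoiPolytope L, ‖x‖ = 1 ∧ (S : Set (Euc n)) = voronoiClass L x := by
  have hLL := hL.1.1
  constructor
  · rintro ⟨⟨x, hx, hS⟩, hmax⟩
    refine ⟨x, voronoiVertices_subset hx, ?_, by rw [hS, hLL.voronoiClass_eq hx]⟩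
    refine le_antisymm (hL.1.norm_le_one (voronoiVertices_subset hx)) ?_
    obtain ⟨z, hz, hz1⟩ := hL.exists_norm_eq_one hn
    have hzV := hL.1.mem_voronoiVertices hz hz1
    have hS' : ((hLL.finite_voronoiClass hz).toFinset : Set (Euc n)) =
        {y | y ∈ voronoiVertices L ∧ y - z ∈ L} := by
      rw [Finite.coe_toFinset, hLL.voronoiClass_eq hzV]
    have := hmax _ ⟨z, hzV, hS'⟩
    rwa [hLL.circumradius_eq hx hS, hLL.circumradius_eq hzV hS', hz1] at this
  · rintro ⟨x, hx, hx1, hS⟩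
    have hxV := hL.1.mem_voronoiVertices hx hx1
    rw [hLL.voronoiClass_eq hxV] at hS
    refine ⟨⟨x, hxV, hS⟩, ?_⟩
    rintro S' ⟨y, hy, hS'⟩
    rw [hLL.circumradius_eq hxV hS, hLL.circumradius_eq hy hS', hx1]
    exact hL.1.norm_le_one (voronoiVertices_subset hy)

/-- The centre of the ball lies in the interior of every maximal simplex: no direction is
obtuse to all its vertices. -/
theorem IsCoveringLattice.exists_inner_pos (hL : IsCoveringLattice (unitBall n) L) {x : Euc n}
    (hx : x ∈ voronoiPolytope L) (hx1 : ‖x‖ = 1) {z : Euc n} (hz : z ≠ 0) :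
    ∃ y ∈ voronoiClass L x, 0 < ⟪y, z⟫ := by
  by_contra! h
  have hzp : 0 < ‖z‖ := norm_pos_iff.2 hz
  obtain ⟨g, hg, hgap⟩ := hL.1.exists_gap x 1
  set s := g / (2 * ‖z‖) with hs
  have hsp : 0 < s := by positivity
  have hsz : ‖s • z‖ = g / 2 := by
    rw [norm_smul, Real.norm_of_nonneg hsp.le, hs]; field_simp
  obtain ⟨l, hl, hxl⟩ := hL.2 (x - s • z)
  rw [unitBall, mem_closedBall_zero_iff] at hxl
  have h1 : ‖x - l‖ ≤ 1 := by
    refine hgap l hl ?_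
    have := norm_add_le (x - s • z - l) (s • z)
    rw [show x - s • z - l + s • z = x - l by abel] at this
    linarith
  have h2 : ‖x - l‖ = ‖x‖ := le_antisymm (h1.trans hx1.ge) (hx l hl)
  have h3 := h (x - l) ⟨sub_mem_voronoiPolytope hx hl h2, by simpa using hl⟩
  have h4 : ‖(x - l) - s • z‖ ^ 2 = 1 - 2 * (s * ⟪x - l, z⟫) + ‖s • z‖ ^ 2 := by
    rw [norm_sub_sq_real, h2, hx1, real_inner_smul_right]; ring
  have h5 : ‖(x - l) - s • z‖ ^ 2 ≤ 1 := by
    rw [show (x - l) - s • z = x - s • z - l by abel]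
    exact pow_le_one₀ (norm_nonneg _) hxl
  rw [hsz] at h4
  nlinarith [mul_nonneg hsp.le (neg_nonneg.2 h3), sq_nonneg g, mul_pos hg hg]

/-! ### Perturbation of the lattice -/

theorem eventually_det_ne_zero :
    ∀ᶠ T : Euc n →L[ℝ] Euc n in 𝓝 (ContinuousLinearMap.id ℝ (Euc n)),
      LinearMap.det T.toLinearMap ≠ 0 := by
  have : ContinuousAt (fun T : Euc n →L[ℝ] Euc n => T.det) (ContinuousLinearMap.id ℝ (Euc n)) :=
    ContinuousLinearMap.continuous_det.continuousAt
  refine this.eventually_ne ?_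
  simp [ContinuousLinearMap.det]

theorem tendsto_norm_sub_id :
    Tendsto (fun T : Euc n →L[ℝ] Euc n => ‖T - ContinuousLinearMap.id ℝ (Euc n)‖)
      (𝓝 (ContinuousLinearMap.id ℝ (Euc n))) (𝓝 0) := by
  have h : Continuous fun T : Euc n →L[ℝ] Euc n => ‖T - ContinuousLinearMap.id ℝ (Euc n)‖ := by
    fun_prop
  simpa using h.tendsto (ContinuousLinearMap.id ℝ (Euc n))

theorem norm_apply_sub_le (T : Euc n →L[ℝ] Euc n) (x : Euc n) :
    ‖T x - x‖ ≤ ‖T - ContinuousLinearMap.id ℝ (Euc n)‖ * ‖x‖ := by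
  simpa using (T - ContinuousLinearMap.id ℝ (Euc n)).le_opNorm x

/-- The Voronoi polytope depends continuously on the lattice. -/
theorem IsLattice.eventually_voronoiPolytope (hL : IsLattice L) {ε : ℝ} (hε : 0 < ε) :
    ∀ᶠ T : Euc n →L[ℝ] Euc n in 𝓝 (ContinuousLinearMap.id ℝ (Euc n)),
      (∀ y ∈ voronoiPolytope (latticeImage T.toLinearMap L),
        (1 + ε)⁻¹ • y ∈ voronoiPolytope L) ∧
      (∀ y ∈ voronoiPolytope L,
        (1 + ε)⁻¹ • y ∈ voronoiPolytope (latticeImage T.toLinearMap L)) := by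
  obtain ⟨m, hm, hmin⟩ := hL.exists_le_norm
  obtain ⟨R, hR⟩ := hL.exists_covering_radius
  have hR0 : 0 ≤ R := by
    obtain ⟨l, -, h⟩ := hR 0
    exact (norm_nonneg _).trans h
  have e1 : ∀ᶠ η : ℝ in 𝓝 0, (1 + η) ^ 2 + 4 * R * η / m < 1 + ε := by
    have : Continuous fun η : ℝ => (1 + η) ^ 2 + 4 * R * η / m := by fun_prop
    exact (this.tendsto 0).eventually_lt_const (by simpa using hε)
  have e2 : ∀ᶠ η : ℝ in 𝓝 0, 0 < (1 + ε) * (1 - η) ^ 2 - (1 + 2 * R * η / m) := by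
    have : Continuous fun η : ℝ => (1 + ε) * (1 - η) ^ 2 - (1 + 2 * R * η / m) := by fun_prop
    exact (this.tendsto 0).eventually_const_lt (by simpa using hε)
  have e3 : ∀ᶠ η : ℝ in 𝓝 0, η < 1 := eventually_lt_nhds one_pos
  have hscale : ∀ (y l : Euc n), 2 * ⟪(1 + ε)⁻¹ • y, l⟫ ≤ ‖l‖ ^ 2 ↔
      2 * ⟪y, l⟫ ≤ (1 + ε) * ‖l‖ ^ 2 := fun y l => by
    rw [real_inner_smul_left, mul_left_comm, inv_mul_le_iff₀ (by positivity)]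
  filter_upwards [tendsto_norm_sub_id.eventually e1, tendsto_norm_sub_id.eventually e2,
    tendsto_norm_sub_id.eventually e3, eventually_det_ne_zero (n := n)] with T h1 h2 h3 hdet
  set η := ‖T - ContinuousLinearMap.id ℝ (Euc n)‖ with hη
  have hη0 : 0 ≤ η := norm_nonneg _
  have hTl : ∀ l : Euc n, ‖T l - l‖ ≤ η * ‖l‖ := norm_apply_sub_le T
  have hup : ∀ l : Euc n, ‖T l‖ ≤ (1 + η) * ‖l‖ := fun l => by
    have := norm_add_le l (T l - l)
    rw [add_sub_cancel] at this
    linarith [hTl l]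
  have hlow : ∀ l : Euc n, (1 - η) * ‖l‖ ≤ ‖T l‖ := fun l => by
    have := norm_sub_le (T l) (T l - l)
    rw [sub_sub_cancel] at this
    linarith [hTl l]
  have hlm : ∀ l ∈ L, ‖l‖ ≤ ‖l‖ ^ 2 / m := fun l hl => by
    rw [le_div_iff₀ hm, sq]
    rcases eq_or_ne l 0 with rfl | h0
    · simp
    · exact mul_le_mul_of_nonneg_left (hmin l hl h0) (norm_nonneg _)
  constructor
  · intro y hy
    have hyR : ‖y‖ ≤ 2 * R := by
      have hsurj : Function.Surjective T := ((Module.End.isUnit_iff _).1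
        ((LinearMap.isUnit_iff_isUnit_det _).2 hdet.isUnit)).2
      obtain ⟨w, rfl⟩ := hsurj y
      obtain ⟨l, hl, hwl⟩ := hR w
      calc ‖T w‖ ≤ ‖T w - T l‖ := hy _ ⟨l, hl, rfl⟩
        _ = ‖T (w - l)‖ := by rw [map_sub]
        _ ≤ (1 + η) * ‖w - l‖ := hup _
        _ ≤ 2 * R := mul_le_mul (by linarith) hwl (norm_nonneg _) (by norm_num)
    rw [mem_voronoiPolytope_iff]
    intro l hl
    rw [hscale]
    have h4 := mem_voronoiPolytope_iff.1 hy (T l) ⟨l, hl, rfl⟩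
    have h5 : ⟪y, l⟫ ≤ ⟪y, T l⟫ + ‖y‖ * ‖T l - l‖ := by
      have := (abs_le.1 (abs_real_inner_le_norm y (T l - l))).1
      rw [inner_sub_right] at this
      linarith
    have h6 : ‖y‖ * ‖T l - l‖ ≤ 2 * R * (η * (‖l‖ ^ 2 / m)) := by
      refine mul_le_mul hyR ((hTl l).trans ?_) (norm_nonneg _) (by positivity)
      exact mul_le_mul_of_nonneg_left (hlm l hl) hη0
    have h7 : ‖T l‖ ^ 2 ≤ (1 + η) ^ 2 * ‖l‖ ^ 2 := by
      rw [← mul_pow]; exact pow_le_pow_left₀ (norm_nonneg _) (hup l) 2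
    have h8 := mul_le_mul_of_nonneg_right h1.le (sq_nonneg ‖l‖)
    have h9 : 2 * (2 * R * (η * (‖l‖ ^ 2 / m))) = 4 * R * η / m * ‖l‖ ^ 2 := by
      field_simp; ring
    rw [add_mul] at h8
    linarith
  · intro y hy
    have hyR : ‖y‖ ≤ R := by
      obtain ⟨l, hl, h⟩ := hR y
      exact (hy l hl).trans h
    rw [mem_voronoiPolytope_iff]
    rintro _ ⟨l, hl, rfl⟩
    change 2 * ⟪(1 + ε)⁻¹ • y, T l⟫ ≤ ‖T l‖ ^ 2
    rw [hscale]
    have h4 := mem_voronoiPolytope_iff.1 hy l hl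
    have h5 : ⟪y, T l⟫ ≤ ⟪y, l⟫ + ‖y‖ * ‖T l - l‖ := by
      have := (abs_le.1 (abs_real_inner_le_norm y (T l - l))).2
      rw [inner_sub_right] at this
      linarith
    have h6 : ‖y‖ * ‖T l - l‖ ≤ R * (η * (‖l‖ ^ 2 / m)) := by
      refine mul_le_mul hyR ((hTl l).trans ?_) (norm_nonneg _) hR0
      exact mul_le_mul_of_nonneg_left (hlm l hl) hη0
    have h7 : (1 - η) ^ 2 * ‖l‖ ^ 2 ≤ ‖T l‖ ^ 2 := by
      rw [← mul_pow]
      exact pow_le_pow_left₀ (mul_nonneg (by linarith) (norm_nonneg _)) (hlow l) 2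
    have h8 := mul_nonneg h2.le (sq_nonneg ‖l‖)
    have h9 : 2 * (R * (η * (‖l‖ ^ 2 / m))) = 2 * R * η / m * ‖l‖ ^ 2 := by
      field_simp
    have h10 := mul_le_mul_of_nonneg_left h7 (show (0 : ℝ) ≤ 1 + ε by positivity)
    nlinarith

end Maximal

/-! ### Genericity: the simplices stay inscribed in spheres -/

section Generic

variable {n : ℕ} {L : Submodule ℤ (Euc n)}

theorem notMem_convexHull_of_mem_extremePoints {P A : Set (Euc n)} {x : Euc n} (hP : Convex ℝ P)
    (hx : x ∈ P.extremePoints ℝ) (hA : A ⊆ P) (hxA : x ∉ A) : x ∉ convexHull ℝ A := by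
  have h1 : Convex ℝ (P \ {x}) := (hP.mem_extremePoints_iff_convex_sdiff.1 hx).2
  have h2 : A ⊆ P \ {x} := fun y hy => ⟨hA hy, fun h => hxA (h ▸ hy)⟩
  exact fun h => (convexHull_min h2 h1 h).2 rfl

/-- A vertex can be separated from the part of the polytope outside a neighbourhood of it, since
vertices are exposed. -/
theorem IsLattice.exists_isClosed_convex (hL : IsLattice L) {x : Euc n}
    (hx : x ∈ voronoiVertices L) {ρ : ℝ} (hρ : 0 < ρ) :
    ∃ C : Set (Euc n), IsClosed C ∧ Convex ℝ C ∧
      (∀ y ∈ voronoiPolytope L, ρ ≤ ‖y - x‖ → y ∈ C) ∧ x ∉ C := by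
  obtain ⟨f, hf⟩ := hL.isExposed_singleton hx (singleton_nonempty x)
  have hK : IsCompact (voronoiPolytope L ∩ {y | ρ ≤ ‖y - x‖}) :=
    hL.isCompact_voronoiPolytope.inter_right (isClosed_le (by fun_prop) (by fun_prop))
  rcases (voronoiPolytope L ∩ {y | ρ ≤ ‖y - x‖}).eq_empty_or_nonempty with he | hne
  · refine ⟨∅, isClosed_empty, convex_empty, fun y hy hyx => ?_, notMem_empty x⟩
    rw [← he]
    exact ⟨hy, hyx⟩
  · obtain ⟨p, hp, hmax⟩ := hK.exists_isMaxOn hne f.continuous.continuousOn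
    refine ⟨{y | f y ≤ f p}, isClosed_le f.continuous continuous_const,
      convex_halfSpace_le f.toLinearMap.isLinear _, fun y hy hyx => hmax ⟨hy, hyx⟩, fun h => ?_⟩
    have hxmax : ∀ y ∈ voronoiPolytope L, f y ≤ f x :=
      (hf.le (mem_singleton x)).2
    have hpx : p ∈ ({x} : Set (Euc n)) := by
      rw [hf]
      exact ⟨hp.1, fun y hy => (hxmax y hy).trans h⟩
    have hp2 : ρ ≤ ‖p - x‖ := hp.2
    rw [mem_singleton_iff.1 hpx, sub_self, norm_zero] at hp2
    linarith

/-- Under small perturbations of the lattice, every vertex of the Voronoi polytope persists. -/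
theorem IsLattice.eventually_exists_vertex_near (hL : IsLattice L) {x : Euc n}
    (hx : x ∈ voronoiVertices L) {ρ : ℝ} (hρ : 0 < ρ) :
    ∀ᶠ T : Euc n →L[ℝ] Euc n in 𝓝 (ContinuousLinearMap.id ℝ (Euc n)),
      ∃ v ∈ voronoiVertices (latticeImage T.toLinearMap L), ‖v - x‖ < ρ := by
  have hP := hL.isCompact_voronoiPolytope
  obtain ⟨R, hR⟩ := hP.isBounded.exists_norm_le
  have hR0 : 0 ≤ R := (norm_nonneg _).trans (hR 0 zero_mem_voronoiPolytope)
  obtain ⟨C, hCc, hCconv, hCP, hxC⟩ :=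
    hL.exists_isClosed_convex hx (show 0 < ρ / 2 by positivity)
  obtain ⟨η, hη, hball⟩ := Metric.isOpen_iff.1 hCc.isOpen_compl x hxC
  set ε := min ρ η / (8 * (R + 1)) with hε
  have hε0 : 0 < ε := by positivity
  have hεR : 8 * (ε * (R + 1)) = min ρ η := by rw [hε]; field_simp
  have hε1 := min_le_left ρ η
  have hε2 := min_le_right ρ η
  filter_upwards [hL.eventually_voronoiPolytope hε0, eventually_det_ne_zero (n := n)] with T h hdet
  by_contra! hfar
  have hLT := hL.image hdet
  set D : Set (Euc n) := {y | (1 + ε)⁻¹ • y ∈ C} with hD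
  have hDconv : Convex ℝ D := hCconv.smul_preimage _
  have hDclosed : IsClosed D := hCc.preimage (continuous_const_smul _)
  have hVD : voronoiVertices (latticeImage T.toLinearMap L) ⊆ D := by
    intro v hv
    have hw := h.1 v (voronoiVertices_subset hv)
    set w := (1 + ε)⁻¹ • v with hwdef
    have hvw : v = (1 + ε) • w := by rw [hwdef, smul_inv_smul₀ (by positivity)]
    refine hCP w hw (le_of_not_gt fun hwx => ?_)
    have h1 : ‖v - x‖ ≤ ‖w - x‖ + ε * ‖w‖ := by
      have : v - x = (w - x) + ε • w := by rw [hvw]; module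
      rw [this]
      refine (norm_add_le _ _).trans ?_
      rw [norm_smul, Real.norm_of_nonneg hε0.le]
    have h2 : ε * ‖w‖ ≤ ε * (R + 1) :=
      mul_le_mul_of_nonneg_left (by linarith [hR w hw]) hε0.le
    linarith [hfar v hv]
  have hPD : voronoiPolytope (latticeImage T.toLinearMap L) ⊆ D := by
    rw [← closure_convexHull_extremePoints hLT.isCompact_voronoiPolytope convex_voronoiPolytope]
    exact closure_minimal (convexHull_min hVD hDconv) hDclosed
  have h3 : (1 + ε)⁻¹ • (1 + ε)⁻¹ • x ∈ C := hPD (h.2 x (voronoiVertices_subset hx))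
  refine hball ?_ h3
  rw [mem_ball_iff_norm, smul_smul]
  have h4 : ((1 + ε)⁻¹ * (1 + ε)⁻¹) • x - x = -((1 - (1 + ε)⁻¹ * (1 + ε)⁻¹) • x) := by module
  have h5 : 0 ≤ 1 - (1 + ε)⁻¹ * (1 + ε)⁻¹ := by
    have : (1 + ε)⁻¹ ≤ 1 := inv_le_one_of_one_le₀ (by linarith)
    have h0 : 0 ≤ (1 + ε)⁻¹ := by positivity
    nlinarith
  have h6 : 1 - (1 + ε)⁻¹ * (1 + ε)⁻¹ ≤ 2 * ε := by
    have : 1 - ε ≤ (1 + ε)⁻¹ := by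
      rw [← one_div, le_div_iff₀ (by positivity)]; nlinarith [sq_nonneg ε]
    have h0 : 0 ≤ (1 + ε)⁻¹ := by positivity
    nlinarith [sq_nonneg (1 - (1 + ε)⁻¹)]
  rw [h4, norm_neg, norm_smul, Real.norm_of_nonneg h5]
  have h7 := mul_le_mul h6 (hR x (voronoiVertices_subset hx)) (norm_nonneg _) (by positivity)
  nlinarith

/-- Every vertex has positive distance from the convex hull of the other vertices. The factor `8`
leaves room for moving the vertices by `ρ` and the points considered near them by `3 * ρ`. -/
theorem IsLattice.eventually_separated (hL : IsLattice L) :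
    ∀ᶠ ρ : ℝ in 𝓝[>] 0, ∀ x ∈ voronoiVertices L,
      ∀ c ∈ convexHull ℝ (voronoiVertices L \ {x}), 8 * ρ ≤ ‖c - x‖ := by
  rw [eventually_all_finite hL.finite_voronoiVertices]
  intro x hx
  have hcl : IsClosed (convexHull ℝ (voronoiVertices L \ {x})) :=
    (hL.finite_voronoiVertices.sdiff (t := {x})).isClosed_convexHull ℝ
  have hxC : x ∉ convexHull ℝ (voronoiVertices L \ {x}) :=
    notMem_convexHull_of_mem_extremePoints convex_voronoiPolytope hx
      (sdiff_subset.trans voronoiVertices_subset) fun h => h.2 rfl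
  obtain ⟨η, hη, hball⟩ := Metric.isOpen_iff.1 hcl.isOpen_compl x hxC
  filter_upwards [Ioo_mem_nhdsGT (show (0 : ℝ) < η / 8 by positivity)] with ρ hρ c hc
  by_contra! h
  refine hball ?_ hc
  rw [mem_ball_iff_norm]
  linarith [hρ.2]

/-- If the vertices of the perturbed polytope correspond one to one to those of the Voronoi
polytope, by a bijection that moves the vertices by less than `ρ`, then a face which comes close
to a vertex contains the corresponding vertex. -/
theorem apply_mem_of_isExtreme {V P F : Set (Euc n)} {φ : Euc n → Euc n} {ρ : ℝ}
    (hF : IsExtreme ℝ P F) (hFc : IsCompact F) (hFconv : Convex ℝ F)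
    (hφ : ∀ v ∈ V, ‖φ v - v‖ < ρ) (hV : P.extremePoints ℝ ⊆ φ '' V) {x y : Euc n}
    (hsep : ∀ c ∈ convexHull ℝ (V \ {x}), 8 * ρ ≤ ‖c - x‖) (hy : y ∈ F)
    (hyx : ‖y - x‖ ≤ 3 * ρ) (hρ : 0 < ρ) : φ x ∈ F := by
  by_contra hx
  have h1 : F.extremePoints ℝ ⊆ Metric.cthickening ρ (convexHull ℝ (V \ {x})) := by
    intro w hw
    obtain ⟨v, hv, rfl⟩ := hV (hF.extremePoints_subset_extremePoints hw)
    have hvx : v ≠ x := fun h => hx (h ▸ hw.1)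
    refine Metric.mem_cthickening_of_dist_le _ v _ _ (subset_convexHull ℝ _ ⟨hv, hvx⟩) ?_
    rw [dist_eq_norm]
    exact (hφ v hv).le
  have h2 : F ⊆ Metric.cthickening ρ (convexHull ℝ (V \ {x})) := by
    conv_lhs => rw [← closure_convexHull_extremePoints hFc hFconv]
    exact closure_minimal (convexHull_min h1 ((convex_convexHull ℝ _).cthickening _))
      Metric.isClosed_cthickening
  have h3 : y ∈ Metric.thickening (2 * ρ) (convexHull ℝ (V \ {x})) :=
    Metric.cthickening_subset_thickening' (by positivity) (by linarith) _ (h2 hy)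
  obtain ⟨c, hc, hyc⟩ := Metric.mem_thickening_iff.1 h3
  rw [dist_eq_norm] at hyc
  have h4 : ‖c - x‖ ≤ ‖y - x‖ + ‖y - c‖ := by
    have := norm_sub_le (y - x) (y - c)
    rwa [sub_sub_sub_cancel_left] at this
  linarith [hsep c hc]

theorem isExtreme_voronoiPolytope_inter {l : Euc n} (hl : l ∈ L) :
    IsExtreme ℝ (voronoiPolytope L) {y | y ∈ voronoiPolytope L ∧ y - l ∈ voronoiPolytope L} := by
  refine ⟨fun y hy => hy.1, ?_⟩
  rintro y hy z hz w ⟨hw, hwl⟩ ⟨a, b, ha, hb, hab, hwyz⟩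
  refine ⟨hy, sub_mem_voronoiPolytope hy hl ?_⟩
  have hact := norm_sub_eq_of_mem hw hl hwl
  rw [norm_sub_eq_norm_iff] at hact ⊢
  have h1 := mem_voronoiPolytope_iff.1 hy l hl
  have h2 := mem_voronoiPolytope_iff.1 hz l hl
  rw [← hwyz, inner_add_left, real_inner_smul_left, real_inner_smul_left] at hact
  have hb' : b = 1 - a := by linarith
  subst hb'
  refine le_antisymm h1 ?_
  by_contra! h3
  have := mul_lt_mul_of_pos_left h3 ha
  nlinarith [mul_le_mul_of_nonneg_left h2 hb.le]

theorem IsLattice.isCompact_voronoiPolytope_inter (hL : IsLattice L) (l : Euc n) :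
    IsCompact {y | y ∈ voronoiPolytope L ∧ y - l ∈ voronoiPolytope L} :=
  hL.isCompact_voronoiPolytope.inter_right
    (isClosed_voronoiPolytope.preimage (continuous_sub_right l))

theorem convex_voronoiPolytope_inter (l : Euc n) :
    Convex ℝ {y | y ∈ voronoiPolytope L ∧ y - l ∈ voronoiPolytope L} := by
  refine fun x hx y hy a b ha hb hab =>
    ⟨convex_voronoiPolytope hx.1 hy.1 ha hb hab, ?_⟩
  have := convex_voronoiPolytope hx.2 hy.2 ha hb hab
  rwa [smul_sub, smul_sub, sub_add_sub_comm, ← add_smul, hab, one_smul] at this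

set_option maxHeartbeats 1000000 in
/-- For a generic lattice, each class of vertices of the Voronoi polytope stays, up to a common
small translation, a set of points of the perturbed polytope; in particular the perturbed points
still lie on a sphere. Otherwise the class would split into several classes, and the perturbed
polytope would have more vertices. -/
theorem Generic.eventually_exists_center (hgen : Generic L) (hL : IsLattice L) {x : Euc n}
    (hx : x ∈ voronoiVertices L) {σ : ℝ} (hσ : 0 < σ) :
    ∀ᶠ T : Euc n →L[ℝ] Euc n in 𝓝 (ContinuousLinearMap.id ℝ (Euc n)),
      ∃ z : Euc n, ‖z‖ ≤ σ ∧ ∀ y ∈ voronoiClass L x,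
        T y - z ∈ voronoiPolytope (latticeImage T.toLinearMap L) := by
  obtain ⟨g, hg, hgap⟩ := hL.exists_gap x ‖x‖
  have hρev : ∀ᶠ ρ : ℝ in 𝓝[>] 0, ρ < min (σ / 2) (g / 8) :=
    Filter.Eventually.filter_mono nhdsWithin_le_nhds (eventually_lt_nhds (by positivity))
  obtain ⟨ρ, ⟨hsep, hρlt⟩, hρ⟩ :=
    ((hL.eventually_separated.and hρev).and self_mem_nhdsWithin).exists
  replace hρ : 0 < ρ := hρ
  have hρσ : 2 * ρ ≤ σ := by linarith [hρlt.trans_le (min_le_left _ _)]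
  have hρg : 8 * ρ ≤ g := by linarith [hρlt.trans_le (min_le_right _ _)]
  have hxP := voronoiVertices_subset hx
  have e1 : ∀ᶠ η : ℝ in 𝓝 0, η * ‖x‖ < ρ := by
    have : Continuous fun η : ℝ => η * ‖x‖ := by fun_prop
    exact (this.tendsto 0).eventually_lt_const (by simpa using hρ)
  have e2 : ∀ᶠ η : ℝ in 𝓝 0, 0 < (1 - η) * (‖x‖ + g) - ((1 + η) * ‖x‖ + g / 2) := by
    have : Continuous fun η : ℝ => (1 - η) * (‖x‖ + g) - ((1 + η) * ‖x‖ + g / 2) := by fun_prop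
    exact (this.tendsto 0).eventually_const_lt (by simp; linarith)
  have e3 : ∀ᶠ η : ℝ in 𝓝 0, η < 1 := eventually_lt_nhds one_pos
  have hnear : ∀ᶠ T : Euc n →L[ℝ] Euc n in 𝓝 (ContinuousLinearMap.id ℝ (Euc n)),
      ∀ v ∈ voronoiVertices L, ∃ w ∈ voronoiVertices (latticeImage T.toLinearMap L),
        ‖w - v‖ < ρ := by
    rw [eventually_all_finite hL.finite_voronoiVertices]
    exact fun v hv => hL.eventually_exists_vertex_near hv hρ
  filter_upwards [hgen, hnear, eventually_det_ne_zero (n := n), tendsto_norm_sub_id.eventually e1,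
    tendsto_norm_sub_id.eventually e2, tendsto_norm_sub_id.eventually e3]
    with T hcomb hnearT hdet h1 h2 h3
  set η := ‖T - ContinuousLinearMap.id ℝ (Euc n)‖ with hη
  have hη0 : 0 ≤ η := norm_nonneg _
  have hTl : ∀ l : Euc n, ‖T l - l‖ ≤ η * ‖l‖ := norm_apply_sub_le T
  set LT := latticeImage T.toLinearMap L with hLTdef
  have hLT : IsLattice LT := hL.image hdet
  choose! φ hφV hφ using hnearT
  have hinj : InjOn φ (voronoiVertices L) := by
    intro v hv w hw hvw
    by_contra hne
    have h4 := hsep v hv w (subset_convexHull ℝ _ ⟨hw, Ne.symm hne⟩)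
    have h5 := norm_sub_le (φ v - v) (φ w - w)
    have h6 := hφ v hv
    rw [hvw] at h6
    rw [hvw, sub_sub_sub_cancel_left] at h5
    linarith [hφ w hw]
  have himage : φ '' voronoiVertices L = voronoiVertices LT := by
    refine Set.eq_of_subset_of_ncard_le (image_subset_iff.2 hφV) ?_ hLT.finite_voronoiVertices
    rw [hinj.ncard_image, hcomb.ncard_voronoiVertices_eq hLT hL]
  have hclsV : ∀ y ∈ voronoiClass L x, y ∈ voronoiVertices L := fun y hy => by
    rw [hL.voronoiClass_eq hx] at hy
    exact hy.1
  have hcls : ∀ y ∈ voronoiClass L x, ‖T y - y‖ ≤ ρ := fun y hy => by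
    have := hTl y
    rw [norm_eq_of_mem_voronoiClass hxP hy] at this
    exact this.trans h1.le
  have hxcls : x ∈ voronoiClass L x := ⟨hxP, by simp⟩
  have hzsmall : ∀ y ∈ voronoiClass L x, ‖T y - φ y‖ ≤ 2 * ρ := by
    intro y hy
    have := norm_sub_le (T y - y) (φ y - y)
    rw [sub_sub_sub_cancel_right] at this
    linarith [hcls y hy, hφ y (hclsV y hy)]
  -- Two members of the class whose perturbed cells meet have the same centre.
  have hlink : ∀ y ∈ voronoiClass L x, ∀ y' ∈ voronoiClass L x, ∀ u : Euc n, ‖u‖ ≤ 2 * ρ →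
      T y - u ∈ voronoiPolytope LT → T y' - u ∈ voronoiPolytope LT →
      T y - φ y = T y' - φ y' := by
    intro y hy y' hy' u hu hyu hyu'
    have hl : y - y' ∈ L := by
      have := L.sub_mem hy.2 hy'.2
      rwa [sub_sub_sub_cancel_right] at this
    have hTlmem : T (y - y') ∈ LT := ⟨_, hl, rfl⟩
    have hyu'' : T y - u - T (y - y') ∈ voronoiPolytope LT := by
      rw [map_sub]; convert hyu' using 1; abel
    have hmem : φ y ∈ {w | w ∈ voronoiPolytope LT ∧ w - T (y - y') ∈ voronoiPolytope LT} := by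
      refine apply_mem_of_isExtreme (isExtreme_voronoiPolytope_inter hTlmem)
        (hLT.isCompact_voronoiPolytope_inter _) (convex_voronoiPolytope_inter _) hφ himage.ge
        (hsep y (hclsV y hy)) ⟨hyu, hyu''⟩ ?_ hρ
      have := norm_sub_le (T y - y) u
      rw [show T y - u - y = T y - y - u by abel]
      linarith [hcls y hy]
    have hvert : φ y - T (y - y') ∈ voronoiVertices LT :=
      hLT.sub_mem_voronoiVertices (hφV y (hclsV y hy)) hTlmem
        (norm_sub_eq_of_mem hmem.1 hTlmem hmem.2)
    obtain ⟨w, hw, hwφ⟩ := himage.ge hvert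
    have hwy' : w = y' := by
      by_contra hne
      have h4 := hsep y' (hclsV y' hy') w (subset_convexHull ℝ _ ⟨hw, hne⟩)
      have h5 : w - y' = (φ y - y) - (T y - y) + (T y' - y') - (φ w - w) := by
        rw [hwφ, map_sub]; abel
      have h6 : ‖w - y'‖ ≤ ‖φ y - y‖ + ‖T y - y‖ + ‖T y' - y'‖ + ‖φ w - w‖ := by
        rw [h5]
        refine (norm_sub_le _ _).trans ?_
        gcongr
        refine (norm_add_le _ _).trans ?_
        gcongr
        exact norm_sub_le _ _
      linarith [hφ w hw, hφ y (hclsV y hy), hcls y hy, hcls y' hy']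
    rw [hwy'] at hwφ
    rw [hwφ, map_sub]
    abel
  -- The perturbed cells of the class cover a neighbourhood of the origin.
  have hcover : ∀ u : Euc n, ‖u‖ ≤ 2 * ρ →
      ∃ y ∈ voronoiClass L x, T y - u ∈ voronoiPolytope LT := by
    intro u hu
    obtain ⟨_, ⟨l, hl, rfl⟩, hmem⟩ := hLT.exists_sub_mem_voronoiPolytope (T x - u)
    change T x - u - T l ∈ _ at hmem
    have hmem' : T (x - l) - u ∈ voronoiPolytope LT := by
      rw [map_sub]; convert hmem using 1; abel
    refine ⟨x - l, ⟨?_, by simpa using hl⟩, hmem'⟩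
    refine sub_mem_voronoiPolytope hxP hl (le_antisymm (hgap l hl ?_) (hxP l hl))
    have h4 : ‖T (x - l) - u‖ ≤ ‖T x - u‖ := by
      have := hmem' (-T l) (LT.neg_mem ⟨l, hl, rfl⟩)
      rwa [map_sub, show T x - T l - u - -T l = T x - u by abel, ← map_sub] at this
    have h5 : (1 - η) * ‖x - l‖ ≤ ‖T (x - l)‖ := by
      have := norm_sub_le (T (x - l)) (T (x - l) - (x - l))
      rw [sub_sub_cancel] at this
      linarith [hTl (x - l)]
    have h6 : ‖T (x - l)‖ ≤ ‖T (x - l) - u‖ + ‖u‖ := by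
      simpa using norm_add_le (T (x - l) - u) u
    have h7 : ‖T x‖ ≤ (1 + η) * ‖x‖ := by
      have := norm_add_le x (T x - x)
      rw [add_sub_cancel] at this
      linarith [hTl x]
    have h8 := norm_sub_le (T x) u
    have h9 : (1 - η) * ‖x - l‖ < (1 - η) * (‖x‖ + g) := by linarith
    exact lt_of_mul_lt_mul_left h9 (by linarith)
  refine ⟨T x - φ x, (hzsmall x hxcls).trans hρσ, fun y hy => ?_⟩
  have heq : T y - φ y = T x - φ x := by
    by_contra hne
    have hfin := hL.finite_voronoiClass hxP
    have hW : ∀ y : Euc n, IsClosed {u | T y - u ∈ voronoiPolytope LT} := fun y =>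
      isClosed_voronoiPolytope.preimage (continuous_sub_left _)
    have hconn : IsPreconnected (Metric.closedBall (0 : Euc n) (2 * ρ)) :=
      (convex_closedBall _ _).isPreconnected
    have hself : ∀ y ∈ voronoiClass L x, T y - (T y - φ y) ∈ voronoiPolytope LT := fun y hy => by
      rw [sub_sub_cancel]
      exact voronoiVertices_subset (hφV y (hclsV y hy))
    obtain ⟨u, hu, hu1, hu2⟩ := isPreconnected_closed_iff.1 hconn
      (⋃ y ∈ {y ∈ voronoiClass L x | T y - φ y = T x - φ x},
        {u | T y - u ∈ voronoiPolytope LT})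
      (⋃ y ∈ {y ∈ voronoiClass L x | T y - φ y ≠ T x - φ x},
        {u | T y - u ∈ voronoiPolytope LT})
      ((hfin.subset (sep_subset _ _)).isClosed_biUnion fun y _ => hW y)
      ((hfin.subset (sep_subset _ _)).isClosed_biUnion fun y _ => hW y)
      (by
        intro u hu
        obtain ⟨y, hy, hyu⟩ := hcover u (mem_closedBall_zero_iff.1 hu)
        by_cases h : T y - φ y = T x - φ x
        · exact Or.inl (mem_biUnion (show y ∈ {y ∈ voronoiClass L x | _} from ⟨hy, h⟩) hyu)
        · exact Or.inr (mem_biUnion (show y ∈ {y ∈ voronoiClass L x | _} from ⟨hy, h⟩) hyu))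
      ⟨T x - φ x, mem_closedBall_zero_iff.2 (hzsmall x hxcls),
        mem_biUnion (show x ∈ {y ∈ voronoiClass L x | _} from ⟨hxcls, rfl⟩) (hself x hxcls)⟩
      ⟨T y - φ y, mem_closedBall_zero_iff.2 (hzsmall y hy),
        mem_biUnion (show y ∈ {y ∈ voronoiClass L x | _} from ⟨hy, hne⟩) (hself y hy)⟩
    obtain ⟨y1, hy1, hyu1⟩ := mem_iUnion₂.1 hu1
    obtain ⟨y2, hy2, hyu2⟩ := mem_iUnion₂.1 hu2
    have := hlink y1 hy1.1 y2 hy2.1 u (mem_closedBall_zero_iff.1 hu) hyu1 hyu2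
    exact hy2.2 (this ▸ hy1.2)
  rw [← heq, sub_sub_cancel]
  exact voronoiVertices_subset (hφV y (hclsV y hy))

end Generic

/-! ### Eutaxy and separation -/

section Eutaxy

variable {n : ℕ}

local notation "⟪" x ", " y "⟫" => inner ℝ x y

/-- The symmetric map `v ↦ ⟨x, v⟩ x` of rank one. -/
noncomputable def rankOneMap (x : Euc n) : Euc n →L[ℝ] Euc n := (innerSL ℝ x).smulRight x

@[simp]
theorem rankOneMap_apply (x v : Euc n) : rankOneMap x v = ⟪x, v⟫ • x := rfl

/-- The trace of a continuous linear map. -/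
noncomputable def traceMap (n : ℕ) : (Euc n →L[ℝ] Euc n) →ₗ[ℝ] ℝ :=
  LinearMap.trace ℝ (Euc n) ∘ₗ ContinuousLinearMap.coeLM ℝ

theorem traceMap_apply (A : Euc n →L[ℝ] Euc n) :
    traceMap n A = ∑ i, ⟪EuclideanSpace.basisFun (Fin n) ℝ i,
      A (EuclideanSpace.basisFun (Fin n) ℝ i)⟫ :=
  LinearMap.trace_eq_sum_inner A.toLinearMap (EuclideanSpace.basisFun (Fin n) ℝ)

theorem traceMap_id : traceMap n (ContinuousLinearMap.id ℝ (Euc n)) = n := by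
  rw [traceMap_apply]
  simp

theorem traceMap_rankOneMap (x : Euc n) : traceMap n (rankOneMap x) = ‖x‖ ^ 2 := by
  rw [traceMap_apply, ← (EuclideanSpace.basisFun (Fin n) ℝ).sum_sq_inner_left x]
  refine Finset.sum_congr rfl fun i _ => ?_
  rw [rankOneMap_apply, real_inner_smul_right, real_inner_comm, sq]

theorem sum_rankOneMap :
    ∑ i, rankOneMap (EuclideanSpace.basisFun (Fin n) ℝ i) = ContinuousLinearMap.id ℝ (Euc n) := by
  ext1 v
  simp only [sum_apply, rankOneMap_apply]
  exact (EuclideanSpace.basisFun (Fin n) ℝ).sum_repr' v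

/-- Every linear functional on the space of maps is represented, on the maps `v ↦ ⟨x, v⟩ x`, by
a quadratic form. -/
theorem exists_quadratic_form (f : (Euc n →L[ℝ] Euc n) →ₗ[ℝ] ℝ) :
    ∃ A : Euc n →L[ℝ] Euc n, traceMap n A = f (ContinuousLinearMap.id ℝ (Euc n)) ∧
      ∀ x, ⟪x, A x⟫ = f (rankOneMap x) := by
  set e := EuclideanSpace.basisFun (Fin n) ℝ with he
  let B : Fin n → Euc n →ₗ[ℝ] ℝ := fun i =>
    { toFun := fun y => f ((innerSL ℝ (e i)).smulRight y)
      map_add' := fun y z => by rw [← map_add]; congr 1; ext1; simp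
      map_smul' := fun c y => by
        rw [RingHom.id_apply, ← map_smul]; congr 1
        exact ContinuousLinearMap.ext fun v => smul_comm ⟪e i, v⟫ c y }
  let A : Euc n →L[ℝ] Euc n := LinearMap.toContinuousLinearMap (∑ i, (B i).smulRight (e i))
  have hA : ∀ y, A y = ∑ i, f ((innerSL ℝ (e i)).smulRight y) • e i := fun y => by
    simp [A, B]
  have key : ∀ x, ⟪x, A x⟫ = f (rankOneMap x) := by
    intro x
    have hx : rankOneMap x = ∑ i, ⟪x, e i⟫ • (innerSL ℝ (e i)).smulRight x := by
      ext1 v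
      simp only [sum_apply, rankOneMap_apply, smul_apply,
        ContinuousLinearMap.smulRight_apply, innerSL_apply_apply, smul_smul]
      rw [← Finset.sum_smul, OrthonormalBasis.sum_inner_mul_inner]
    rw [hA, hx, map_sum, inner_sum]
    refine Finset.sum_congr rfl fun i _ => ?_
    rw [real_inner_smul_right, map_smul, smul_eq_mul, mul_comm]
  refine ⟨A, ?_, key⟩
  rw [traceMap_apply, ← sum_rankOneMap, map_sum]
  exact Finset.sum_congr rfl fun i _ => key _

/-- A theorem of the alternative: either the identity is a nonnegative combination of given maps
of trace one, or it is separated from all of them. -/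
theorem exists_sum_eq_id_or_exists_functional (hn : 1 ≤ n) (G : Finset (Euc n →L[ℝ] Euc n))
    (hG : ∀ Q ∈ G, traceMap n Q = 1) :
    (∃ u : (Euc n →L[ℝ] Euc n) → ℝ, (∀ Q ∈ G, 0 ≤ u Q) ∧
      ∑ Q ∈ G, u Q • Q = ContinuousLinearMap.id ℝ (Euc n)) ∨
    ∃ f : (Euc n →L[ℝ] Euc n) →ₗ[ℝ] ℝ, 0 < f (ContinuousLinearMap.id ℝ (Euc n)) ∧
      ∀ Q ∈ G, f Q < 0 := by
  have hn0 : (0 : ℝ) < n := by exact_mod_cast hn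
  by_cases h : (n : ℝ)⁻¹ • ContinuousLinearMap.id ℝ (Euc n) ∈
      convexHull ℝ (G : Set (Euc n →L[ℝ] Euc n))
  · left
    obtain ⟨w, hw0, hw1, hw⟩ := Finset.mem_convexHull'.1 h
    refine ⟨fun Q => n * w Q, fun Q hQ => mul_nonneg hn0.le (hw0 Q hQ), ?_⟩
    simp only [mul_smul]
    rw [← Finset.smul_sum, hw, smul_inv_smul₀ hn0.ne']
  · right
    obtain ⟨f, u, hfG, hfid⟩ := geometric_hahn_banach_closed_point (convex_convexHull ℝ _)
      (G.finite_toSet.isClosed_convexHull ℝ) h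
    refine ⟨f.toLinearMap - u • traceMap n, ?_, fun Q hQ => ?_⟩
    · simp only [map_smul, smul_eq_mul] at hfid
      rw [lt_inv_mul_iff₀ hn0] at hfid
      simp only [LinearMap.sub_apply, LinearMap.smul_apply, traceMap_id, smul_eq_mul]
      change 0 < f (ContinuousLinearMap.id ℝ (Euc n)) - u * n
      linarith
    · have := hfG Q (subset_convexHull ℝ _ hQ)
      simp only [LinearMap.sub_apply, LinearMap.smul_apply, hG Q hQ, smul_eq_mul]
      change f Q - u * 1 < 0
      linarith

theorem semiEutacticMaps_of_sum_eq_id {M : Set (Euc n →ₗ[ℝ] Euc n)}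
    (G : Finset (Euc n →L[ℝ] Euc n)) (hG : ∀ Q ∈ G, Q.toLinearMap ∈ M)
    (u : (Euc n →L[ℝ] Euc n) → ℝ) (hu : ∀ Q ∈ G, 0 ≤ u Q)
    (hid : ∑ Q ∈ G, u Q • Q = ContinuousLinearMap.id ℝ (Euc n)) : SemiEutacticMaps M := by
  classical
  set c : (Euc n →ₗ[ℝ] Euc n) ≃ₗ[ℝ] (Euc n →L[ℝ] Euc n) := LinearMap.toContinuousLinearMap with hc
  have hcoe : ∀ Q : Euc n →L[ℝ] Euc n, c.symm Q = Q.toLinearMap := fun Q => rfl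
  have hmem : ∀ Q', Q' ∈ G.map c.symm.toEquiv.toEmbedding ↔ c Q' ∈ G := fun Q' => by
    simp only [Finset.mem_map_equiv]; rfl
  let U : (Euc n →ₗ[ℝ] Euc n) →₀ ℝ := Finsupp.onFinset (G.map c.symm.toEquiv.toEmbedding)
    (fun Q' => if c Q' ∈ G then u (c Q') else 0) fun Q' hQ' => by
      rw [hmem]
      by_contra h
      exact hQ' (if_neg h)
  have hU : ∀ Q', U Q' = if c Q' ∈ G then u (c Q') else 0 := fun Q' => rfl
  refine ⟨U, ?_, fun Q' => ?_, ?_⟩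
  · intro Q' hQ'
    rw [Finset.mem_coe, Finsupp.mem_support_iff, hU] at hQ'
    have h : c Q' ∈ G := by
      by_contra h
      exact hQ' (if_neg h)
    have := hG _ h
    rwa [← hcoe, c.symm_apply_apply] at this
  · rw [hU]
    split_ifs with h
    · exact hu _ h
    · exact le_rfl
  · rw [Finsupp.sum_of_support_subset U Finsupp.support_onFinset_subset _ (by simp),
      Finset.sum_map]
    have h1 : ∀ Q ∈ G, U (c.symm.toEquiv.toEmbedding Q) • c.symm.toEquiv.toEmbedding Q =
        c.symm (u Q • Q) := by
      intro Q hQ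
      have h2 : c.symm.toEquiv.toEmbedding Q = c.symm Q := rfl
      rw [h2, hU, c.apply_symm_apply, if_pos hQ, map_smul]
    rw [Finset.sum_congr rfl h1, ← map_sum, hid]
    rfl

/-- Along a direction of positive trace the determinant increases. -/
theorem eventually_one_lt_det {A : Euc n →L[ℝ] Euc n} (hA : 0 < traceMap n A) :
    ∀ᶠ t : ℝ in 𝓝[>] 0,
      1 < LinearMap.det (ContinuousLinearMap.id ℝ (Euc n) + t • A).toLinearMap := by
  set b := (EuclideanSpace.basisFun (Fin n) ℝ).toBasis with hb
  set M := LinearMap.toMatrix b b A.toLinearMap with hM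
  set p : Polynomial ℝ := (Matrix.det (1 + (Polynomial.X : Polynomial ℝ) •
    M.map Polynomial.C)).divX.divX with hp
  have htr : traceMap n A = M.trace := LinearMap.trace_eq_matrix_trace ℝ b A.toLinearMap
  have hdet : ∀ t : ℝ, LinearMap.det (ContinuousLinearMap.id ℝ (Euc n) + t • A).toLinearMap =
      1 + M.trace * t + p.eval t * t ^ 2 := by
    intro t
    rw [← Matrix.det_one_add_smul, ← LinearMap.det_toMatrix b]
    congr 1
    change LinearMap.toMatrix b b (LinearMap.id + t • A.toLinearMap) = _
    rw [map_add, map_smul, LinearMap.toMatrix_id]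
  have hev : ∀ᶠ t : ℝ in 𝓝[>] 0, 0 < M.trace + p.eval t * t := by
    have hcont : Continuous fun t : ℝ => M.trace + p.eval t * t := by fun_prop
    refine Filter.Eventually.filter_mono nhdsWithin_le_nhds ?_
    exact (hcont.tendsto 0).eventually_const_lt (by simpa [← htr] using hA)
  filter_upwards [hev, self_mem_nhdsWithin] with t ht ht0
  rw [hdet]
  have := mul_pos ht (show (0 : ℝ) < t from ht0)
  nlinarith

/-- Let a simplex inscribed in the unit sphere contain `0` in its interior, and let `A` shrink its
vertices on average. Then every small translate of the simplex deformed by `1 + t A` has a vertex in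
the unit ball. If all vertices were outside, the average would force the square of the
translation to be at least of order `t`, while interiority of `0` bounds the translation by a
multiple of `t`. -/
theorem eventually_exists_norm_le_one {S : Finset (Euc n)} {α : Euc n → ℝ} {δ : ℝ}
    {A : Euc n →L[ℝ] Euc n} (hS : ∀ y ∈ S, ‖y‖ = 1) (hα : ∀ y ∈ S, 0 ≤ α y)
    (hα1 : ∑ y ∈ S, α y = 1) (hα0 : ∑ y ∈ S, α y • y = 0) (hδ : 0 < δ)
    (hδS : ∀ z : Euc n, ∃ y ∈ S, δ * ‖z‖ ≤ ⟪y, z⟫) (hA : ∑ y ∈ S, α y * ⟪y, A y⟫ < 0) :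
    ∀ᶠ σ : ℝ in 𝓝[>] 0, ∀ᶠ t : ℝ in 𝓝[>] 0, ∀ z : Euc n, ‖z‖ ≤ σ →
      ∃ y ∈ S, ‖y + t • A y - z‖ ≤ 1 := by
  set κ := -∑ y ∈ S, α y * ⟪y, A y⟫ with hκ
  have hκ0 : 0 < κ := by rw [hκ]; linarith
  set m := ‖A‖ with hm
  have hm0 : 0 ≤ m := norm_nonneg A
  set C := m ^ 2 + 4 * m + 1 with hC
  have hC0 : 0 < C := by positivity
  have hAy : ∀ y ∈ S, ‖A y‖ ≤ m := fun y hy => by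
    have := A.le_opNorm y
    rwa [hS y hy, mul_one] at this
  filter_upwards [Ioo_mem_nhdsGT (show (0 : ℝ) < min δ 1 by positivity)] with σ hσ
  have hσδ : σ < δ := hσ.2.trans_le (min_le_left _ _)
  have hσ1 : σ < 1 := hσ.2.trans_le (min_le_right _ _)
  have e1 : ∀ᶠ t : ℝ in 𝓝[>] 0, t * (C ^ 2 + C * δ ^ 2) < κ * δ ^ 2 := by
    have hcont : Continuous fun t : ℝ => t * (C ^ 2 + C * δ ^ 2) := by fun_prop
    refine Filter.Eventually.filter_mono nhdsWithin_le_nhds ?_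
    exact (hcont.tendsto 0).eventually_lt_const (by simp; positivity)
  filter_upwards [e1, Ioo_mem_nhdsGT (show (0 : ℝ) < 1 from one_pos)] with t ht ht01 z hz
  have ht0 : 0 < t := ht01.1
  by_contra! hbig
  have hexp : ∀ y ∈ S, ‖y + t • A y - z‖ ^ 2 =
      1 + 2 * t * ⟪y, A y⟫ + t ^ 2 * ‖A y‖ ^ 2 - 2 * ⟪y, z⟫ - 2 * t * ⟪A y, z⟫ + ‖z‖ ^ 2 := by
    intro y hy
    rw [norm_sub_sq_real, norm_add_sq_real, hS y hy, inner_add_left, real_inner_smul_left,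
      real_inner_smul_right, norm_smul, Real.norm_of_nonneg ht0.le]
    ring
  have hgt : ∀ y ∈ S, 1 < ‖y + t • A y - z‖ ^ 2 := fun y hy => one_lt_pow₀ (hbig y hy) two_ne_zero
  -- Averaging over the vertices bounds the translation from below.
  have hsum : 1 ≤ ∑ y ∈ S, α y * ‖y + t • A y - z‖ ^ 2 := by
    rw [← hα1]
    exact Finset.sum_le_sum fun y hy => le_mul_of_one_le_right (hα y hy) (hgt y hy).le
  have hinner : ∑ y ∈ S, α y * ⟪y, z⟫ = 0 := by
    rw [← inner_zero_left (𝕜 := ℝ) z, ← hα0, sum_inner]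
    exact Finset.sum_congr rfl fun y _ => (real_inner_smul_left _ _ _).symm
  have hinnerA : ∑ y ∈ S, α y * ⟪A y, z⟫ = 0 := by
    have : ∑ y ∈ S, α y • A y = 0 := by
      rw [← map_zero A, ← hα0, map_sum]
      exact Finset.sum_congr rfl fun y _ => (map_smul A _ _).symm
    rw [← inner_zero_left (𝕜 := ℝ) z, ← this, sum_inner]
    exact Finset.sum_congr rfl fun y _ => (real_inner_smul_left _ _ _).symm
  have hsumA : ∑ y ∈ S, α y * ‖A y‖ ^ 2 ≤ m ^ 2 := by
    calc ∑ y ∈ S, α y * ‖A y‖ ^ 2 ≤ ∑ y ∈ S, α y * m ^ 2 :=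
          Finset.sum_le_sum fun y hy => mul_le_mul_of_nonneg_left
            (pow_le_pow_left₀ (norm_nonneg _) (hAy y hy) 2) (hα y hy)
      _ = m ^ 2 := by rw [← Finset.sum_mul, hα1, one_mul]
  have hsum2 : ∑ y ∈ S, α y * ‖y + t • A y - z‖ ^ 2 =
      1 - 2 * t * κ + t ^ 2 * (∑ y ∈ S, α y * ‖A y‖ ^ 2) + ‖z‖ ^ 2 := by
    have : ∀ y ∈ S, α y * ‖y + t • A y - z‖ ^ 2 =
        α y * (1 + ‖z‖ ^ 2) + 2 * t * (α y * ⟪y, A y⟫) + t ^ 2 * (α y * ‖A y‖ ^ 2)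
          - 2 * (α y * ⟪y, z⟫) - 2 * t * (α y * ⟪A y, z⟫) := fun y hy => by
      rw [hexp y hy]; ring
    rw [Finset.sum_congr rfl this]
    simp only [Finset.sum_add_distrib, Finset.sum_sub_distrib, ← Finset.mul_sum,
      ← Finset.sum_mul]
    rw [hα1, hinner, hinnerA, hκ]
    ring
  have hzlow : 2 * t * κ ≤ t ^ 2 * m ^ 2 + ‖z‖ ^ 2 := by
    have := mul_le_mul_of_nonneg_left hsumA (sq_nonneg t)
    linarith
  -- The vertex closest to the direction of the translation bounds it from above.
  obtain ⟨y, hy, hyz⟩ := hδS z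
  have h1 := hgt y hy
  rw [hexp y hy] at h1
  have h2 : ⟪y, A y⟫ ≤ m := by
    have := real_inner_le_norm y (A y)
    rw [hS y hy, one_mul] at this
    exact this.trans (hAy y hy)
  have h3 : -⟪A y, z⟫ ≤ m := by
    have h4 := (abs_le.1 (abs_real_inner_le_norm (A y) z)).1
    have h5 : ‖A y‖ * ‖z‖ ≤ m * 1 :=
      mul_le_mul (hAy y hy) (hz.trans hσ1.le) (norm_nonneg _) hm0
    linarith
  have h4 : ‖A y‖ ^ 2 ≤ m ^ 2 := pow_le_pow_left₀ (norm_nonneg _) (hAy y hy) 2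
  have h5 : ‖z‖ ^ 2 ≤ δ * ‖z‖ := by
    rw [sq]; exact mul_le_mul_of_nonneg_right (hz.trans hσδ.le) (norm_nonneg _)
  have h6 : δ * ‖z‖ ≤ C * t := by
    have h7 : 2 * t * ⟪y, A y⟫ ≤ 2 * t * m := mul_le_mul_of_nonneg_left h2 (by positivity)
    have h8 : 2 * t * -⟪A y, z⟫ ≤ 2 * t * m := mul_le_mul_of_nonneg_left h3 (by positivity)
    have h9 : t ^ 2 * ‖A y‖ ^ 2 ≤ t * m ^ 2 :=
      mul_le_mul (by rw [sq]; exact mul_le_of_le_one_left ht0.le ht01.2.le) h4 (sq_nonneg _) ht0.le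
    rw [hC]
    linarith [mul_pos ht0 one_pos]
  have h7 : δ ^ 2 * ‖z‖ ^ 2 ≤ C ^ 2 * t ^ 2 := by
    rw [← mul_pow, ← mul_pow]
    exact pow_le_pow_left₀ (by positivity) h6 2
  have h8 : m ^ 2 ≤ C := by rw [hC]; linarith
  have h9 : 2 * t * κ * δ ^ 2 ≤ t ^ 2 * C * δ ^ 2 + C ^ 2 * t ^ 2 := by
    have h10 := mul_le_mul_of_nonneg_right hzlow (sq_nonneg δ)
    have h11 : t ^ 2 * m ^ 2 * δ ^ 2 ≤ t ^ 2 * C * δ ^ 2 := by gcongr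
    linarith
  have h10 := mul_lt_mul_of_pos_left ht ht0
  have h11 : 0 < t * κ * δ ^ 2 := by positivity
  linarith

end Eutaxy

/-! ### Deforming a lattice that is not redundantly semi-eutactic -/

section Deformation

variable {n : ℕ} {L : Submodule ℤ (Euc n)}

local notation "⟪" x ", " y "⟫" => inner ℝ x y

/-- The centre of the ball is a convex combination of the vertices of a maximal simplex. -/
theorem IsCoveringLattice.exists_weights (hL : IsCoveringLattice (unitBall n) L) {x : Euc n}
    (hx : x ∈ voronoiPolytope L) (hx1 : ‖x‖ = 1) {S : Finset (Euc n)}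
    (hS : (S : Set (Euc n)) = voronoiClass L x) :
    ∃ α : Euc n → ℝ, (∀ y ∈ S, 0 ≤ α y) ∧ ∑ y ∈ S, α y = 1 ∧ ∑ y ∈ S, α y • y = 0 := by
  rw [← Finset.mem_convexHull' (R := ℝ)]
  by_contra h
  obtain ⟨f, u, hf, h0⟩ := geometric_hahn_banach_closed_point (convex_convexHull ℝ _)
    (S.finite_toSet.isClosed_convexHull ℝ) h
  rw [map_zero] at h0
  have hneg : ∀ y ∈ voronoiClass L x, f y < 0 := fun y hy =>
    (hf y (subset_convexHull ℝ _ (hS.ge hy))).trans h0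
  set z := (InnerProductSpace.toDual ℝ (Euc n)).symm f with hz
  have hfz : ∀ y, ⟪y, z⟫ = f y := fun y => by
    rw [real_inner_comm, hz, InnerProductSpace.toDual_symm_apply]
  have hz0 : z ≠ 0 := by
    intro h0
    have h1 := hneg x ⟨hx, by simp⟩
    rw [← hfz, h0, inner_zero_right] at h1
    exact lt_irrefl _ h1
  obtain ⟨y, hy, hyz⟩ := hL.exists_inner_pos hx hx1 hz0
  rw [hfz] at hyz
  exact lt_asymm hyz (hneg y hy)

/-- A uniform version of `IsCoveringLattice.exists_inner_pos`. -/
theorem IsCoveringLattice.exists_inner_ge (hL : IsCoveringLattice (unitBall n) L) {x : Euc n}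
    (hx : x ∈ voronoiPolytope L) (hx1 : ‖x‖ = 1) {S : Finset (Euc n)}
    (hS : (S : Set (Euc n)) = voronoiClass L x) :
    ∃ δ > 0, ∀ z : Euc n, ∃ y ∈ S, δ * ‖z‖ ≤ ⟪y, z⟫ := by
  have hxS : x ∈ S := hS.ge ⟨hx, by simp⟩
  have hne : S.Nonempty := ⟨x, hxS⟩
  have hcont : Continuous fun z : Euc n => S.sup' hne fun y => ⟪y, z⟫ :=
    Continuous.finset_sup'_apply hne fun y _ => by fun_prop
  obtain ⟨z₀, hz₀, hmin⟩ := (isCompact_sphere (0 : Euc n) 1).exists_isMinOn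
    ⟨x, by simpa using hx1⟩ hcont.continuousOn
  have hz₀1 : ‖z₀‖ = 1 := by simpa using hz₀
  have hz₀0 : z₀ ≠ 0 := fun h => by simp [h] at hz₀1
  refine ⟨S.sup' hne fun y => ⟪y, z₀⟫, ?_, fun z => ?_⟩
  · obtain ⟨y, hy, hpos⟩ := hL.exists_inner_pos hx hx1 hz₀0
    exact hpos.trans_le (Finset.le_sup' (fun y => ⟪y, z₀⟫) (hS.ge hy))
  · rcases eq_or_ne z 0 with rfl | hz
    · exact ⟨x, hxS, by simp⟩
    · have hzp : 0 < ‖z‖ := norm_pos_iff.2 hz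
      obtain ⟨y, hy, hmax⟩ := Finset.exists_mem_eq_sup' hne fun y => ⟪y, ‖z‖⁻¹ • z⟫
      have h1 : ‖z‖⁻¹ • z ∈ Metric.sphere (0 : Euc n) 1 := by
        simp [norm_smul, hzp.ne']
      have h2 := hmin h1
      simp only [mem_ofPred_eq] at h2
      rw [hmax, real_inner_smul_right, le_inv_mul_iff₀ hzp, mul_comm] at h2
      exact ⟨y, hy, h2⟩

/-- The points of a perturbed Voronoi polytope that are not in the unit ball are close to
vertices of maximal norm. -/
theorem IsCoveringLattice.eventually_near_unit (hL : IsCoveringLattice (unitBall n) L) {σ : ℝ}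
    (hσ : 0 < σ) :
    ∀ᶠ T : Euc n →L[ℝ] Euc n in 𝓝 (ContinuousLinearMap.id ℝ (Euc n)),
      ∀ y ∈ voronoiPolytope (latticeImage T.toLinearMap L), 1 < ‖y‖ →
        ∃ x ∈ voronoiPolytope L, ‖x‖ = 1 ∧ ‖y - x‖ < σ := by
  have hK : IsCompact (voronoiPolytope L ∩
      ⋂ x ∈ {x ∈ voronoiPolytope L | ‖x‖ = 1}, {w | σ / 2 ≤ ‖w - x‖}) :=
    hL.1.isCompact_voronoiPolytope.inter_right
      (isClosed_biInter fun x _ => isClosed_le (by fun_prop) (by fun_prop))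
  set K := voronoiPolytope L ∩
    ⋂ x ∈ {x ∈ voronoiPolytope L | ‖x‖ = 1}, {w | σ / 2 ≤ ‖w - x‖} with hKdef
  have hKmem : ∀ w ∈ voronoiPolytope L,
      (∀ x ∈ voronoiPolytope L, ‖x‖ = 1 → σ / 2 ≤ ‖w - x‖) → w ∈ K := fun w hw h =>
    ⟨hw, mem_iInter₂.2 fun x hx => h x hx.1 hx.2⟩
  obtain ⟨r, hr0, hr1, hr⟩ : ∃ r : ℝ, 0 ≤ r ∧ r < 1 ∧ ∀ w ∈ K, ‖w‖ ≤ r := by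
    rcases K.eq_empty_or_nonempty with he | hne
    · exact ⟨0, le_rfl, one_pos, by simp [he]⟩
    · obtain ⟨w, hw, hmax⟩ := hK.exists_isMaxOn hne continuous_norm.continuousOn
      refine ⟨‖w‖, norm_nonneg _, lt_of_le_of_ne (hL.norm_le_one hw.1) fun h => ?_, hmax⟩
      have h1 : σ / 2 ≤ ‖w - w‖ := mem_iInter₂.1 hw.2 w ⟨hw.1, h⟩
      rw [sub_self, norm_zero] at h1
      linarith
  set ε := min (1 - r) (σ / 4) with hε
  have hε0 : 0 < ε := lt_min (by linarith) (by linarith)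
  have hε1 : ε ≤ 1 - r := min_le_left _ _
  have hε2 : ε ≤ σ / 4 := min_le_right _ _
  filter_upwards [hL.1.eventually_voronoiPolytope hε0] with T hT y hy hy1
  have hw := hT.1 y hy
  set w := (1 + ε)⁻¹ • y with hwdef
  have hyw : y = (1 + ε) • w := by rw [hwdef, smul_inv_smul₀ (by positivity)]
  have hw1 := hL.norm_le_one hw
  have hywε : ‖y - w‖ ≤ ε := by
    have : y - w = ε • w := by rw [hyw]; module
    rw [this, norm_smul, Real.norm_of_nonneg hε0.le]
    exact mul_le_of_le_one_right hε0.le hw1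
  by_contra! hfar
  have hwK : w ∈ K := by
    refine hKmem w hw fun x hx hx1 => ?_
    have h1 := hfar x hx hx1
    have h2 := norm_add_le (y - w) (w - x)
    rw [sub_add_sub_cancel] at h2
    linarith
  have h3 : ‖y‖ = (1 + ε) * ‖w‖ := by
    rw [hyw, norm_smul, Real.norm_of_nonneg (by positivity)]
  nlinarith [hr w hwK]

theorem mem_negSimplex {S : Finset (Euc n)} {x : Euc n} : x ∈ negSimplex S ↔ -x ∈ S := by
  simp only [negSimplex, Finset.mem_map_equiv]
  rfl

/-- If the maximal simplices other than `±S₀` are not semi-eutactic, then the lattice can be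
deformed so that its determinant increases, while the ball still covers everything except for
small neighbourhoods of the vertices of `±S₀`. -/
theorem IsCriticalLattice.exists_deformation (hn : 1 ≤ n) (hL : IsCriticalLattice (unitBall n) L)
    {S₀ : Finset (Euc n)} (hneut : ¬ SemiEutactic (maximalSimplices L \ {S₀, negSimplex S₀}))
    {x₁ : Euc n} (hx₁ : x₁ ∈ S₀) (hx₁1 : ‖x₁‖ = 1) {ρ : ℝ} (hρ : 0 < ρ) :
    ∃ T : Euc n →L[ℝ] Euc n, 1 < LinearMap.det T.toLinearMap ∧
      ∀ y ∈ voronoiPolytope (latticeImage T.toLinearMap L),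
        ‖y‖ ≤ 1 ∨ ∃ l ∈ latticeImage T.toLinearMap L, ‖y - l - x₁‖ ≤ ρ ∨ ‖y - l + x₁‖ ≤ ρ := by
  have hcov := hL.1
  have hLL := hcov.1
  have hSex : ∀ x ∈ {x ∈ voronoiPolytope L | ‖x‖ = 1}, ∃ S : Finset (Euc n),
      (S : Set (Euc n)) = voronoiClass L x := fun x hx =>
    ⟨(hLL.finite_voronoiClass hx.1).toFinset, Finite.coe_toFinset _⟩
  choose! S hS using hSex
  have hαex : ∀ x ∈ {x ∈ voronoiPolytope L | ‖x‖ = 1}, ∃ α : Euc n → ℝ,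
      (∀ y ∈ S x, 0 ≤ α y) ∧ ∑ y ∈ S x, α y = 1 ∧ ∑ y ∈ S x, α y • y = 0 := fun x hx =>
    hcov.exists_weights hx.1 hx.2 (hS x hx)
  choose! α hα0 hα1 hαz using hαex
  have hunit : ∀ x ∈ {x ∈ voronoiPolytope L | ‖x‖ = 1}, ∀ y ∈ S x, ‖y‖ = 1 := fun x hx y hy =>
    (norm_eq_of_mem_voronoiClass hx.1 ((hS x hx).le hy)).trans hx.2
  set U := {x ∈ voronoiPolytope L | ‖x‖ = 1} ∩ {x | S x ≠ S₀ ∧ S x ≠ negSimplex S₀} with hU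
  have hUfin : U.Finite := hLL.finite_voronoiVertices.subset fun x hx =>
    hcov.mem_voronoiVertices hx.1.1 hx.1.2
  set Q : Euc n → Euc n →L[ℝ] Euc n := fun x => ∑ y ∈ S x, α x y • rankOneMap y with hQ
  classical
  have htr : ∀ q ∈ hUfin.toFinset.image Q, traceMap n q = 1 := by
    intro q hq
    obtain ⟨x, hx, rfl⟩ := Finset.mem_image.1 hq
    have hxU := ((Finite.mem_toFinset _).1 hx).1
    rw [hQ, map_sum, ← hα1 x hxU]
    refine Finset.sum_congr rfl fun y hy => ?_
    rw [map_smul, traceMap_rankOneMap, hunit x hxU y hy, one_pow, smul_eq_mul, mul_one]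
  rcases exists_sum_eq_id_or_exists_functional hn _ htr with ⟨u, hu, hid⟩ | ⟨f, hfid, hfQ⟩
  · refine absurd (semiEutacticMaps_of_sum_eq_id _ (fun q hq => ?_) u hu hid) hneut
    obtain ⟨x, hx, rfl⟩ := Finset.mem_image.1 hq
    obtain ⟨hxU, hx2⟩ := (Finite.mem_toFinset _).1 hx
    refine ⟨S x, ⟨(hL.mem_maximalSimplices_iff hn).2 ⟨x, hxU.1, hxU.2, hS x hxU⟩, ?_⟩,
      α x, hαz x hxU, hα1 x hxU, fun v => ?_⟩
    · simpa using hx2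
    · change (∑ y ∈ S x, α x y • rankOneMap y) v = _
      simp only [sum_apply, smul_apply, rankOneMap_apply, smul_smul]
  obtain ⟨A, hAtr, hA⟩ := exists_quadratic_form f
  have hAneg : ∀ x ∈ U, ∑ y ∈ S x, α x y * ⟪y, A y⟫ < 0 := by
    intro x hx
    have := hfQ (Q x) (Finset.mem_image_of_mem _ ((Finite.mem_toFinset _).2 hx))
    rw [hQ, map_sum] at this
    refine lt_of_eq_of_lt (Finset.sum_congr rfl fun y _ => ?_) this
    rw [hA, map_smul, smul_eq_mul]
  have hlocal : ∀ᶠ σ : ℝ in 𝓝[>] 0, ∀ x ∈ U, ∀ᶠ t : ℝ in 𝓝[>] 0, ∀ z : Euc n, ‖z‖ ≤ σ →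
      ∃ y ∈ S x, ‖y + t • A y - z‖ ≤ 1 := by
    rw [eventually_all_finite hUfin]
    intro x hx
    obtain ⟨δ, hδ, hδS⟩ := hcov.exists_inner_ge hx.1.1 hx.1.2 (hS x hx.1)
    exact eventually_exists_norm_le_one (hunit x hx.1) (hα0 x hx.1) (hα1 x hx.1) (hαz x hx.1)
      hδ hδS (hAneg x hx)
  obtain ⟨σ, ⟨hσloc, hσρ⟩, hσ0⟩ := ((hlocal.and (Filter.Eventually.filter_mono nhdsWithin_le_nhds
    (eventually_lt_nhds (show (0 : ℝ) < ρ by exact hρ)))).and self_mem_nhdsWithin).exists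
  replace hσ0 : 0 < σ := hσ0
  have hT : Tendsto (fun t : ℝ => ContinuousLinearMap.id ℝ (Euc n) + t • A) (𝓝[>] 0)
      (𝓝 (ContinuousLinearMap.id ℝ (Euc n))) := by
    have hc : Continuous fun t : ℝ => ContinuousLinearMap.id ℝ (Euc n) + t • A := by fun_prop
    have h0 : ContinuousLinearMap.id ℝ (Euc n) + (0 : ℝ) • A = ContinuousLinearMap.id ℝ (Euc n) :=
      ContinuousLinearMap.ext fun v => by simp
    have := (hc.tendsto 0).mono_left (nhdsWithin_le_nhds (s := Ioi 0))
    rwa [h0] at this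
  have hsmall : ∀ᶠ T : Euc n →L[ℝ] Euc n in 𝓝 (ContinuousLinearMap.id ℝ (Euc n)),
      ‖T - ContinuousLinearMap.id ℝ (Euc n)‖ < σ / 4 :=
    tendsto_norm_sub_id.eventually (eventually_lt_nhds (by positivity))
  rw [← eventually_all_finite hUfin] at hσloc
  obtain ⟨t, ⟨⟨hdet, hloc⟩, hTs⟩, hnear⟩ := (((eventually_one_lt_det (hAtr ▸ hfid)).and hσloc).and
    (hT.eventually hsmall)).and (hT.eventually (hcov.eventually_near_unit
      (show 0 < σ / 2 by positivity))) |>.exists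
  set T := ContinuousLinearMap.id ℝ (Euc n) + t • A with hTdef
  have hTapp : ∀ v, T v = v + t • A v := fun v => rfl
  have hTl : ∀ v, ‖T v - v‖ ≤ σ / 4 * ‖v‖ := fun v =>
    (norm_apply_sub_le T v).trans (mul_le_mul_of_nonneg_right hTs.le (norm_nonneg _))
  refine ⟨T, hdet, fun y hy => or_iff_not_imp_left.2 fun hy1 => ?_⟩
  rw [not_le] at hy1
  obtain ⟨x, hx, hx1, hyx⟩ := hnear y hy hy1
  have hxU : x ∈ {x ∈ voronoiPolytope L | ‖x‖ = 1} := ⟨hx, hx1⟩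
  -- If `y` is close to `x` and `x` is congruent to `w`, then `y` is congruent to a point near `w`.
  have hmove : ∀ w : Euc n, ‖w‖ = 1 → w - x ∈ L →
      ∃ l ∈ latticeImage T.toLinearMap L, ‖y - l - w‖ ≤ ρ := by
    intro w hw1 hw
    have hl : x - w ∈ L := by simpa using L.neg_mem hw
    refine ⟨T (x - w), ⟨x - w, hl, rfl⟩, ?_⟩
    have h1 : ‖x - w‖ ≤ 2 := (norm_sub_le _ _).trans (by linarith)
    have h2 := hTl (x - w)
    have h3 : y - T (x - w) - w = (y - x) - (T (x - w) - (x - w)) := by abel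
    rw [h3]
    refine (norm_sub_le _ _).trans ?_
    have h4 : σ / 4 * ‖x - w‖ ≤ σ / 4 * 2 := mul_le_mul_of_nonneg_left h1 (by positivity)
    linarith
  by_cases h1 : S x = S₀
  · rw [← h1] at hx₁
    obtain ⟨l, hl, h⟩ := hmove x₁ hx₁1 ((hS x hxU).le hx₁).2
    exact ⟨l, hl, Or.inl h⟩
  by_cases h2 : S x = negSimplex S₀
  · have hx₁' : -x₁ ∈ S x := by rw [h2, mem_negSimplex, neg_neg]; exact hx₁
    obtain ⟨l, hl, h⟩ := hmove (-x₁) (by rw [norm_neg, hx₁1]) ((hS x hxU).le hx₁').2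
    exact ⟨l, hl, Or.inr (by rwa [sub_neg_eq_add] at h)⟩
  have hzσ : ‖T x - y‖ ≤ σ := by
    have h3 := hTl x
    rw [hx1, mul_one] at h3
    have h4 := norm_sub_le (T x - x) (y - x)
    rw [sub_sub_sub_cancel_right] at h4
    linarith
  obtain ⟨w, hw, hwle⟩ := hloc x ⟨hxU, h1, h2⟩ (T x - y) hzσ
  have hwx : x - w ∈ L := by simpa using L.neg_mem ((hS x hxU).le hw).2
  have h3 := hy (T (x - w)) ⟨x - w, hwx, rfl⟩
  rw [← hTapp, show T w - (T x - y) = y - T (x - w) by rw [map_sub]; abel] at hwle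
  exact absurd (h3.trans hwle) (not_le.2 hy1)

theorem abs_det_linearIsometryEquiv (U : Euc n ≃ₗᵢ[ℝ] Euc n) :
    |LinearMap.det U.toLinearEquiv.toLinearMap| = 1 := by
  rw [← LinearMap.normDet_eq_abs_det]
  exact U.toLinearIsometry.normDet_eq_one

/-- Without redundancy, every larger symmetric body admits a covering lattice of larger
determinant: a deformed and suitably rotated lattice. -/
theorem IsCriticalLattice.inextensible (hn : 1 ≤ n) (hL : IsCriticalLattice (unitBall n) L)
    {S₀ : Finset (Euc n)} (hS₀ : S₀ ∈ maximalSimplices L)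
    (hneut : ¬ SemiEutactic (maximalSimplices L \ {S₀, negSimplex S₀})) :
    Inextensible (unitBall n) := by
  intro K' hK' hsub
  obtain ⟨hBK, p, hpK, hpB⟩ := (ssubset_iff_of_subset hsub.subset).1 hsub |> fun h =>
    And.intro hsub.subset h
  have hp1 : 1 < ‖p‖ := by
    rw [unitBall, mem_closedBall_zero_iff, not_le] at hpB
    exact hpB
  set s := ‖p‖⁻¹ with hs
  have hs0 : 0 < s := by positivity
  have hs1 : s < 1 := inv_lt_one_of_one_lt₀ hp1
  set q := s • p with hq
  have hq1 : ‖q‖ = 1 := by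
    rw [hq, norm_smul, Real.norm_of_nonneg hs0.le, hs, inv_mul_cancel₀ (by positivity)]
  have hball : ∀ v : Euc n, ‖v - q‖ ≤ 1 - s → v ∈ K' := by
    intro v hv
    have h1 : (1 - s)⁻¹ • (v - q) ∈ K' := hBK <| by
      rw [unitBall, mem_closedBall_zero_iff, norm_smul, norm_inv,
        Real.norm_of_nonneg (by linarith), inv_mul_le_iff₀ (by linarith), mul_one]
      exact hv
    have h2 := hK'.convex hpK h1 hs0.le (show 0 ≤ 1 - s by linarith) (by ring)
    rwa [smul_inv_smul₀ (by linarith), ← hq, add_sub_cancel] at h2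
  have hball' : ∀ v : Euc n, ‖v + q‖ ≤ 1 - s → v ∈ K' := by
    intro v hv
    have := hK'.neg_mem _ (hball (-v) (by rw [← norm_neg]; simpa [add_comm] using hv))
    rwa [neg_neg] at this
  obtain ⟨x₁, hx₁P, hx₁1, hS₀x⟩ := (hL.mem_maximalSimplices_iff hn).1 hS₀
  have hx₁S : x₁ ∈ S₀ := hS₀x.ge ⟨hx₁P, by simp⟩
  obtain ⟨T, hdet, hT⟩ := hL.exists_deformation hn hneut hx₁S hx₁1 (show 0 < 1 - s by linarith)
  set U : Euc n ≃ₗᵢ[ℝ] Euc n := (ℝ ∙ (x₁ - q))ᗮ.reflection with hU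
  have hUx : U x₁ = q := Submodule.reflection_sub (hx₁1.trans hq1.symm)
  have hdetT : LinearMap.det T.toLinearMap ≠ 0 := by linarith
  have hdetU := abs_det_linearIsometryEquiv U
  have hdetU0 : LinearMap.det U.toLinearEquiv.toLinearMap ≠ 0 := fun h => by
    rw [h, abs_zero] at hdetU
    exact zero_ne_one hdetU
  have hLT := hL.1.1.image hdetT
  have hcov : IsCoveringLattice K' (latticeImage U.toLinearEquiv.toLinearMap
      (latticeImage T.toLinearMap L)) := by
    refine ⟨hLT.image hdetU0, fun y => ?_⟩
    obtain ⟨l, hl, hyl⟩ := hLT.exists_sub_mem_voronoiPolytope (U.symm y)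
    have hUl : ∀ l : Euc n, y - U l = U (U.symm y - l) := fun l => by
      rw [map_sub, U.apply_symm_apply]
    rcases hT _ hyl with h | ⟨l', hl', h⟩
    · refine ⟨U l, ⟨l, hl, rfl⟩, hBK ?_⟩
      rw [hUl, unitBall, mem_closedBall_zero_iff, U.norm_map]
      exact h
    · refine ⟨U (l + l'), ⟨l + l', Submodule.add_mem _ hl hl', rfl⟩, ?_⟩
      rw [hUl, ← sub_sub]
      rcases h with h | h
      · refine hball _ ?_
        rwa [← hUx, ← map_sub, U.norm_map]
      · refine hball' _ ?_
        rwa [← hUx, ← map_add, U.norm_map]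
  have h1 := hcov.covolume_le_criticalDet hK'.isCompact
  rw [covolume_latticeImage hLT hdetU0, covolume_latticeImage hL.1.1 hdetT, hdetU, one_mul,
    abs_of_pos (by linarith)] at h1
  rw [← hL.2]
  have h2 := hL.1.1.covolume_pos
  nlinarith

end Deformation

/-! ### The ball with a pair of caps -/

section CappedBall

variable {n : ℕ}

local notation "⟪" x ", " y "⟫" => inner ℝ x y

/-- The convex hull of the unit ball and the points `p`, `-p`: the union of the balls around the
points `s p`, `|s| ≤ 1`, with radii `1 - |s|`. -/
def cappedBall (p : Euc n) : Set (Euc n) := {x | ∃ s : ℝ, ‖x - s • p‖ ≤ 1 - |s|}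

theorem unitBall_subset_cappedBall (p : Euc n) : unitBall n ⊆ cappedBall p := fun x hx =>
  ⟨0, by simpa [unitBall] using hx⟩

theorem mem_cappedBall_self (p : Euc n) : p ∈ cappedBall p := ⟨1, by simp⟩

theorem norm_le_of_mem_cappedBall {p x : Euc n} (hp : 1 ≤ ‖p‖) (hx : x ∈ cappedBall p) :
    ‖x‖ ≤ ‖p‖ := by
  obtain ⟨s, hs⟩ := hx
  have h1 := norm_add_le (x - s • p) (s • p)
  rw [sub_add_cancel, norm_smul, Real.norm_eq_abs] at h1
  have h2 : |s| ≤ 1 := by linarith [norm_nonneg (x - s • p)]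
  nlinarith [abs_nonneg s]

theorem isSymmetricBody_cappedBall (p : Euc n) : IsSymmetricBody (cappedBall p) where
  convex := by
    rintro x ⟨s, hs⟩ y ⟨r, hr⟩ a b ha hb hab
    refine ⟨a * s + b * r, ?_⟩
    have h1 : a • x + b • y - (a * s + b * r) • p = a • (x - s • p) + b • (y - r • p) := by
      module
    have h2 : |a * s + b * r| ≤ a * |s| + b * |r| := by
      refine (abs_add_le _ _).trans ?_
      rw [abs_mul, abs_mul, abs_of_nonneg ha, abs_of_nonneg hb]
    have h3 := norm_add_le (a • (x - s • p)) (b • (y - r • p))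
    rw [norm_smul, norm_smul, Real.norm_of_nonneg ha, Real.norm_of_nonneg hb] at h3
    rw [h1]
    nlinarith [mul_le_mul_of_nonneg_left hs ha, mul_le_mul_of_nonneg_left hr hb]
  isCompact := by
    have h1 : IsCompact ((Icc (-1 : ℝ) 1 ×ˢ Metric.closedBall (0 : Euc n) (1 + ‖p‖)) ∩
        {q : ℝ × Euc n | ‖q.2 - q.1 • p‖ ≤ 1 - |q.1|}) :=
      (isCompact_Icc.prod (isCompact_closedBall _ _)).inter_right
        (isClosed_le (by fun_prop) (by fun_prop))
    convert! h1.image continuous_snd using 1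
    ext x
    constructor
    · rintro ⟨s, hs⟩
      have h2 : |s| ≤ 1 := by linarith [norm_nonneg (x - s • p)]
      refine ⟨(s, x), ⟨⟨abs_le.1 h2, mem_closedBall_zero_iff.2 ?_⟩, hs⟩, rfl⟩
      have h1 := norm_add_le (x - s • p) (s • p)
      rw [sub_add_cancel, norm_smul, Real.norm_eq_abs] at h1
      nlinarith [abs_nonneg s, norm_nonneg p]
    · rintro ⟨⟨s, y⟩, ⟨-, h⟩, rfl⟩
      exact ⟨s, h⟩
  interior_nonempty := by
    refine ⟨0, interior_mono (unitBall_subset_cappedBall p) ?_⟩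
    rw [mem_interior_iff_mem_nhds]
    exact Metric.closedBall_mem_nhds _ one_pos
  neg_mem := by
    rintro x ⟨s, hs⟩
    refine ⟨-s, ?_⟩
    rwa [abs_neg, neg_smul, sub_neg_eq_add, ← norm_neg, neg_add, neg_neg, ← sub_eq_add_neg]

/-- The caps are small when `p` is close to the unit sphere. -/
theorem dist_sq_le_of_mem_cappedBall {p x : Euc n} (hx : x ∈ cappedBall p) (hx1 : 1 < ‖x‖) :
    ‖x - p‖ ^ 2 ≤ ‖p‖ ^ 2 - 1 ∨ ‖x + p‖ ^ 2 ≤ ‖p‖ ^ 2 - 1 := by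
  have main : ∀ (q : Euc n) (s : ℝ), 0 ≤ s → ‖x - s • q‖ ≤ 1 - s → ‖x - q‖ ^ 2 ≤ ‖q‖ ^ 2 - 1 := by
    intro q s hs0 hs
    set u := x - s • q with hu
    have hs1 : s ≤ 1 := by linarith [norm_nonneg u]
    have hxu : x = u + s • q := by rw [hu]; abel
    have hx2 : ‖x‖ ^ 2 = ‖u‖ ^ 2 + 2 * (s * ⟪u, q⟫) + s ^ 2 * ‖q‖ ^ 2 := by
      rw [hxu, norm_add_sq_real, real_inner_smul_right, norm_smul, mul_pow, Real.norm_eq_abs,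
        sq_abs]
    have hxq : ‖x - q‖ ^ 2 = ‖u‖ ^ 2 - 2 * ((1 - s) * ⟪u, q⟫) + (1 - s) ^ 2 * ‖q‖ ^ 2 := by
      have : x - q = u - (1 - s) • q := by rw [hxu]; module
      rw [this, norm_sub_sq_real, real_inner_smul_right, norm_smul, mul_pow, Real.norm_eq_abs,
        sq_abs]
    have hxgt : 1 < ‖x‖ ^ 2 := one_lt_pow₀ hx1 two_ne_zero
    have hu2 : ‖u‖ ^ 2 ≤ (1 - s) ^ 2 := pow_le_pow_left₀ (norm_nonneg _) hs 2
    have hspos : 0 < s := by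
      rcases hs0.eq_or_lt with h | h
      · rw [← h] at hu2 hx2
        rw [hx2] at hxgt
        nlinarith
      · exact h
    have h1 : (1 - s) * (1 - ‖u‖ ^ 2 - s ^ 2 * ‖q‖ ^ 2) ≤ (1 - s) * (2 * (s * ⟪u, q⟫)) :=
      mul_le_mul_of_nonneg_left (by linarith) (by linarith)
    have h2 : s * ‖x - q‖ ^ 2 ≤ s * ((1 - s) * (‖q‖ ^ 2 - 1)) := by
      rw [hxq]
      linarith
    have h3 := le_of_mul_le_mul_left h2 hspos
    have hq : 1 ≤ ‖q‖ := by
      by_contra! hq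
      have h4 := norm_add_le u (s • q)
      rw [← hxu, norm_smul, Real.norm_of_nonneg hs0] at h4
      nlinarith
    have h4 : 1 ≤ ‖q‖ ^ 2 := one_le_pow₀ hq
    nlinarith
  obtain ⟨s, hs⟩ := hx
  rcases le_total 0 s with h | h
  · rw [abs_of_nonneg h] at hs
    exact Or.inl (main p s h hs)
  · rw [abs_of_nonpos h] at hs
    right
    have := main (-p) (-s) (by linarith) (by rwa [smul_neg, neg_smul, neg_neg])
    rwa [sub_neg_eq_add, norm_neg] at this

end CappedBall

/-! ### Compactness of the space of covering lattices -/

section Compactness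

variable {n : ℕ}

theorem exists_tendsto_of_norm_le {ι : Type*} (F : Ultrafilter ι) {u : ι → Euc n}
    {R : ℝ} (h : ∀ᶠ k in (F : Filter ι), ‖u k‖ ≤ R) :
    ∃ x : Euc n, Tendsto u F (𝓝 x) := by
  obtain ⟨x, -, hx⟩ := (isCompact_closedBall (0 : Euc n) R).ultrafilter_le_nhds' (F.map u)
    (Ultrafilter.mem_map.2 (by filter_upwards [h] with k hk; exact mem_closedBall_zero_iff.2 hk))
  exact ⟨x, hx⟩

/-- The limits, along an ultrafilter, of the sequences of points of given lattices. -/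
def limitLattice {ι : Type*} (F : Ultrafilter ι) (Λ : ι → Submodule ℤ (Euc n)) :
    Submodule ℤ (Euc n) where
  carrier := {x | ∃ l : ι → Euc n, (∀ k, l k ∈ Λ k) ∧ Tendsto l F (𝓝 x)}
  add_mem' := by
    rintro x y ⟨l, hl, hlx⟩ ⟨l', hl', hly⟩
    exact ⟨fun k => l k + l' k, fun k => (Λ k).add_mem (hl k) (hl' k), hlx.add hly⟩
  zero_mem' := ⟨fun _ => 0, fun k => (Λ k).zero_mem, tendsto_const_nhds⟩
  smul_mem' := by
    rintro c x ⟨l, hl, hlx⟩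
    exact ⟨fun k => c • l k, fun k => (Λ k).smul_mem c (hl k), hlx.const_smul c⟩

/-- The uniform bound on short vectors makes the limit discrete; it has full rank because it still
has bounded covering radius. -/
theorem isLattice_limitLattice {ι : Type*} (F : Ultrafilter ι) {Λ : ι → Submodule ℤ (Euc n)}
    {r m : ℝ} (hΛ : ∀ k, IsCoveringLattice (Metric.closedBall 0 r) (Λ k)) (hm : 0 < m)
    (hmin : ∀ k, ∀ v ∈ Λ k, v ≠ 0 → m ≤ ‖v‖) : IsLattice (limitLattice F Λ) := by
  have hdisc : DiscreteTopology (limitLattice F Λ) := by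
    refine DiscreteTopology.of_forall_le_norm hm ?_
    rintro ⟨x, l, hl, hlx⟩ hx0
    have hx0' : x ≠ 0 := fun h => hx0 (Subtype.ext h)
    refine ge_of_tendsto hlx.norm ?_
    filter_upwards [hlx.eventually_ne hx0'] with k hk
    exact hmin k _ (hl k) hk
  refine ⟨hdisc, ⟨?_⟩⟩
  rw [← Submodule.orthogonal_eq_bot_iff, Submodule.eq_bot_iff]
  intro y hy
  by_contra hy0
  have hyp : 0 < ‖y‖ := norm_pos_iff.2 hy0
  obtain ⟨c, hc⟩ : ∃ c : ℝ, r < c * ‖y‖ ∧ 0 ≤ c := by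
    refine ⟨(|r| + 1) / ‖y‖, ?_, by positivity⟩
    rw [div_mul_cancel₀ _ hyp.ne']
    linarith [le_abs_self r]
  choose l hl hlr using fun k => (hΛ k).2 (c • y)
  obtain ⟨x, hx⟩ := exists_tendsto_of_norm_le F (u := l) (R := r + ‖c • y‖)
    (Eventually.of_forall fun k => by
      have h1 := norm_sub_le (c • y) (c • y - l k)
      rw [sub_sub_cancel] at h1
      linarith [mem_closedBall_zero_iff.1 (hlr k)])
  have hxr : ‖c • y - x‖ ≤ r :=
    le_of_tendsto (hx.const_sub (c • y)).norm
      (Eventually.of_forall fun k => mem_closedBall_zero_iff.1 (hlr k))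
  have hxL : x ∈ Submodule.span ℝ (limitLattice F Λ : Set (Euc n)) :=
    Submodule.subset_span ⟨l, hl, hx⟩
  have horth : inner ℝ (c • y) x = 0 := by
    rw [real_inner_smul_left, Submodule.inner_left_of_mem_orthogonal hxL hy, mul_zero]
  have h1 : ‖c • y‖ ^ 2 ≤ ‖c • y - x‖ ^ 2 := by
    rw [norm_sub_sq_real, horth]
    nlinarith [sq_nonneg ‖x‖]
  have h2 := (pow_le_pow_iff_left₀ (norm_nonneg _) (norm_nonneg _) two_ne_zero).1 h1
  rw [norm_smul, Real.norm_of_nonneg hc.2] at h2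
  linarith [hc.1]

/-- Selection theorem: covering lattices whose covolumes are bounded below are, along an
ultrafilter, small deformations of a single lattice. -/
theorem exists_tendsto_latticeImage {ι : Type*} (F : Ultrafilter ι) {Λ : ι → Submodule ℤ (Euc n)}
    {r d : ℝ} (hΛ : ∀ k, IsCoveringLattice (Metric.closedBall 0 r) (Λ k)) (hd : 0 < d)
    (hvol : ∀ k, d ≤ ZLattice.covolume (Λ k)) :
    IsLattice (limitLattice F Λ) ∧ ∃ T : ι → Euc n →L[ℝ] Euc n,
      Tendsto T F (𝓝 (ContinuousLinearMap.id ℝ (Euc n))) ∧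
      ∀ᶠ k in (F : Filter ι), Λ k = latticeImage (T k).toLinearMap (limitLattice F Λ) := by
  obtain ⟨m, hm, hmin⟩ : ∃ m > 0, ∀ k, ∀ v ∈ Λ k, v ≠ 0 → m ≤ ‖v‖ := by
    set V := volume.real (Metric.closedBall (0 : Euc n) (r + 1)) with hV
    have hV0 : 0 ≤ V := measureReal_nonneg
    refine ⟨d / (V + 1), by positivity, fun k v hv hv0 => ?_⟩
    have h1 := (hΛ k).covolume_le_norm_mul hv hv0
    rw [div_le_iff₀ (by positivity)]
    nlinarith [hvol k, norm_nonneg v]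
  have hLL := isLattice_limitLattice F hΛ hm hmin
  refine ⟨hLL, ?_⟩
  obtain ⟨b, hb⟩ := hLL.exists_basis
  have hbmem : ∀ i, b i ∈ limitLattice F Λ := fun i => by
    rw [hb]; exact Submodule.subset_span (mem_range_self i)
  choose β hβ hβb using hbmem
  set T : ι → Euc n →L[ℝ] Euc n := fun k =>
    ∑ i, (LinearMap.toContinuousLinearMap (b.coord i)).smulRight (β i k) with hT
  have hTb : ∀ k i, T k (b i) = β i k := by
    intro k i
    simp [hT, sum_apply, Finsupp.single_apply, ite_smul]
  have hTlim : Tendsto T F (𝓝 (ContinuousLinearMap.id ℝ (Euc n))) := by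
    have hid : ContinuousLinearMap.id ℝ (Euc n) =
        ∑ i, (LinearMap.toContinuousLinearMap (b.coord i)).smulRight (b i) := by
      refine ContinuousLinearMap.ext fun v => ?_
      simp only [sum_apply, ContinuousLinearMap.smulRight_apply,
        LinearMap.coe_toContinuousLinearMap', Basis.coord_apply, b.sum_repr,
        ContinuousLinearMap.id_apply]
    rw [hid]
    refine tendsto_finsetSum _ fun i _ => ?_
    exact ((ContinuousLinearMap.smulRightL ℝ (Euc n) (Euc n)
      (LinearMap.toContinuousLinearMap (b.coord i))).continuous.tendsto (b i)).comp (hβb i)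
  refine ⟨T, hTlim, ?_⟩
  have hle : ∀ k, latticeImage (T k).toLinearMap (limitLattice F Λ) ≤ Λ k := by
    intro k
    rw [hb, latticeImage_span, Submodule.span_le]
    rintro _ ⟨i, rfl⟩
    change T k (b i) ∈ Λ k
    rw [hTb]
    exact hβ i k
  -- A point of `Λ k` outside the deformed lattice can be reduced to a bounded one; its limit
  -- belongs to the limit lattice, which produces arbitrarily short vectors.
  by_contra hne
  rw [Ultrafilter.eventually_not.symm] at hne
  obtain ⟨R, hR⟩ := hLL.isCompact_voronoiPolytope.isBounded.exists_norm_le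
  have hex : ∀ k, ∃ w ∈ Λ k,
      (Λ k ≠ latticeImage (T k).toLinearMap (limitLattice F Λ) →
        LinearMap.det (T k).toLinearMap ≠ 0 →
          w ∉ latticeImage (T k).toLinearMap (limitLattice F Λ) ∧
          w ∈ voronoiPolytope (latticeImage (T k).toLinearMap (limitLattice F Λ))) := by
    intro k
    by_cases h : Λ k ≠ latticeImage (T k).toLinearMap (limitLattice F Λ) ∧
      LinearMap.det (T k).toLinearMap ≠ 0
    · obtain ⟨w, hw, hwn⟩ := SetLike.exists_of_lt (lt_of_le_of_ne (hle k) h.1.symm)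
      obtain ⟨l, hl, hwl⟩ := (hLL.image h.2).exists_sub_mem_voronoiPolytope w
      refine ⟨w - l, (Λ k).sub_mem hw (hle k hl), fun _ _ => ⟨fun hmem => hwn ?_, hwl⟩⟩
      simpa using Submodule.add_mem _ hmem hl
    · exact ⟨0, (Λ k).zero_mem, fun h1 h2 => absurd ⟨h1, h2⟩ h⟩
  choose w hwΛ hw using hex
  have hbound : ∀ᶠ k in (F : Filter ι), ‖w k‖ ≤ 2 * R := by
    filter_upwards [hne, hTlim.eventually eventually_det_ne_zero,
      hTlim.eventually (hLL.eventually_voronoiPolytope one_pos)] with k h1 h2 h3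
    have := hR _ (h3.1 _ (hw k h1 h2).2)
    rw [norm_smul, norm_inv, Real.norm_of_nonneg (by norm_num), inv_mul_le_iff₀ (by norm_num)]
      at this
    linarith
  obtain ⟨x, hx⟩ := exists_tendsto_of_norm_le F hbound
  have hxL : x ∈ limitLattice F Λ := ⟨w, hwΛ, hx⟩
  have hTx : Tendsto (fun k => w k - T k x) F (𝓝 0) := by
    have h1 : Tendsto (fun k => T k x) F (𝓝 x) :=
      ((ContinuousLinearMap.apply ℝ (Euc n) x).continuous.tendsto _).comp hTlim
    simpa using hx.sub h1
  obtain ⟨k, ⟨⟨h1, h2⟩, h3⟩⟩ := ((hne.and (hTlim.eventually eventually_det_ne_zero)).and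
    (hTx.norm.eventually (eventually_lt_nhds (by simpa using hm)))).exists
  have hTxmem : T k x ∈ latticeImage (T k).toLinearMap (limitLattice F Λ) := ⟨x, hxL, rfl⟩
  have h4 : w k - T k x = 0 := by
    by_contra h0
    exact absurd (hmin k _ ((Λ k).sub_mem (hwΛ k) (hle k hTxmem)) h0) (not_le.2 h3)
  have h5 := (hw k h1 h2).1
  rw [sub_eq_zero.1 h4] at h5
  exact h5 hTxmem

end Compactness

/-! ### The determinant bound from semi-eutaxy -/

section DetBound

variable {n : ℕ} {L : Submodule ℤ (Euc n)}

local notation "⟪" x ", " y "⟫" => inner ℝ x y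

/-- Hadamard's inequality and the inequality of the arithmetic and geometric means, combined. -/
theorem abs_det_le_one (T : Euc n →L[ℝ] Euc n)
    (hT : ∑ i, ‖T (EuclideanSpace.basisFun (Fin n) ℝ i)‖ ^ 2 ≤ n) :
    |LinearMap.det T.toLinearMap| ≤ 1 := by
  set e := EuclideanSpace.basisFun (Fin n) ℝ with he
  have : Fact (finrank ℝ (Euc n) = n) := ⟨by simp⟩
  have h1 : |LinearMap.det T.toLinearMap| ≤ ∏ i, ‖T (e i)‖ := by
    have h2 := e.toBasis.orientation.abs_volumeForm_apply_le fun i => T (e i)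
    rw [Orientation.volumeForm_robust' _ e] at h2
    have h3 : (fun i => T (e i)) = T.toLinearMap ∘ e.toBasis := by
      ext i; simp
    rw [h3, Basis.det_comp, Basis.det_self, mul_one] at h2
    simpa using h2
  refine h1.trans ?_
  rw [← sq_le_one_iff₀ (Finset.prod_nonneg fun i _ => norm_nonneg _), ← Finset.prod_pow]
  calc ∏ i, ‖T (e i)‖ ^ 2 ≤ ∏ i, Real.exp (‖T (e i)‖ ^ 2 - 1) :=
        Finset.prod_le_prod (fun i _ => sq_nonneg _) fun i _ => by
          have := Real.add_one_le_exp (‖T (e i)‖ ^ 2 - 1)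
          linarith
    _ = Real.exp (∑ i, (‖T (e i)‖ ^ 2 - 1)) := (Real.exp_sum _ _).symm
    _ ≤ 1 := by
      rw [Real.exp_le_one_iff, Finset.sum_sub_distrib]
      simpa using hT

/-- The pairing `Q ↦ tr (Tᵀ T Q)`. -/
noncomputable def gramPairing (T : Euc n →L[ℝ] Euc n) : (Euc n →ₗ[ℝ] Euc n) →ₗ[ℝ] ℝ where
  toFun Q := ∑ i, ⟪T (EuclideanSpace.basisFun (Fin n) ℝ i),
    T (Q (EuclideanSpace.basisFun (Fin n) ℝ i))⟫
  map_add' Q Q' := by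
    simp only [LinearMap.add_apply, map_add, inner_add_right, Finset.sum_add_distrib]
  map_smul' c Q := by
    simp only [LinearMap.smul_apply, map_smul, real_inner_smul_right, ← Finset.mul_sum,
      smul_eq_mul, RingHom.id_apply]

theorem gramPairing_apply (T : Euc n →L[ℝ] Euc n) (Q : Euc n →ₗ[ℝ] Euc n) :
    gramPairing T Q = ∑ i, ⟪T (EuclideanSpace.basisFun (Fin n) ℝ i),
      T (Q (EuclideanSpace.basisFun (Fin n) ℝ i))⟫ := rfl

theorem gramPairing_id (T : Euc n →L[ℝ] Euc n) :
    gramPairing T LinearMap.id = ∑ i, ‖T (EuclideanSpace.basisFun (Fin n) ℝ i)‖ ^ 2 := by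
  rw [gramPairing_apply]
  exact Finset.sum_congr rfl fun i _ => real_inner_self_eq_norm_sq _

theorem gramPairing_simplexMap (T : Euc n →L[ℝ] Euc n) {S : Finset (Euc n)} {α : Euc n → ℝ}
    {Q : Euc n →ₗ[ℝ] Euc n} (hQ : ∀ v, Q v = ∑ x ∈ S, (α x * ⟪x, v⟫) • x) :
    gramPairing T Q = ∑ x ∈ S, α x * ‖T x‖ ^ 2 := by
  set e := EuclideanSpace.basisFun (Fin n) ℝ with he
  have hTx : ∀ x, T x = ∑ i, ⟪x, e i⟫ • T (e i) := fun x => by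
    conv_lhs => rw [← e.sum_repr' x, map_sum]
    exact Finset.sum_congr rfl fun i _ => by rw [map_smul, real_inner_comm]
  rw [gramPairing_apply]
  simp only [hQ, map_sum, map_smul, inner_sum, real_inner_smul_right]
  rw [Finset.sum_comm]
  refine Finset.sum_congr rfl fun x _ => ?_
  rw [← real_inner_self_eq_norm_sq]
  conv_rhs => rw [hTx x, sum_inner, ← hTx x, Finset.mul_sum]
  refine Finset.sum_congr rfl fun i _ => ?_
  rw [real_inner_smul_left]
  ring

/-- If the perturbed simplex lies on a sphere, then its pairing with the Gram matrix is at most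
the square of the radius. -/
theorem gramPairing_le {T : Euc n →L[ℝ] Euc n} {S : Finset (Euc n)} {Q : Euc n →ₗ[ℝ] Euc n}
    (hQ : IsSimplexMap S Q) {z : Euc n} {r : ℝ} (hr : ∀ x ∈ S, ‖T x - z‖ = r) :
    gramPairing T Q ≤ r ^ 2 := by
  obtain ⟨α, h0, h1, hQ⟩ := hQ
  rw [gramPairing_simplexMap T hQ]
  have h2 : ∀ x ∈ S, α x * ‖T x‖ ^ 2 = α x * (r ^ 2 - ‖z‖ ^ 2) + 2 * ⟪T (α x • x), z⟫ := by
    intro x hx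
    rw [← hr x hx, norm_sub_sq_real, map_smul, real_inner_smul_left]
    ring
  rw [Finset.sum_congr rfl h2, Finset.sum_add_distrib, ← Finset.sum_mul, h1, ← Finset.mul_sum,
    ← sum_inner, ← map_sum, h0, map_zero, inner_zero_left]
  nlinarith [sq_nonneg ‖z‖]

theorem gramPairing_id_eq_one {S : Finset (Euc n)} {Q : Euc n →ₗ[ℝ] Euc n}
    (hQ : IsSimplexMap S Q) (hS : ∀ x ∈ S, ‖x‖ = 1) :
    gramPairing (ContinuousLinearMap.id ℝ (Euc n)) Q = 1 := by
  obtain ⟨α, -, h1, hQ⟩ := hQ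
  rw [gramPairing_simplexMap _ hQ, ← h1]
  refine Finset.sum_congr rfl fun x hx => ?_
  rw [ContinuousLinearMap.id_apply, hS x hx, one_pow, mul_one]

/-- If the perturbed Gram matrix pairs to at most one with the maps of a semi-eutactic family of
simplices inscribed in the unit sphere, then the perturbation does not increase volumes. -/
theorem abs_det_le_one_of_eutactic {T : Euc n →L[ℝ] Euc n} {u : (Euc n →ₗ[ℝ] Euc n) →₀ ℝ}
    (hu : ∀ Q, 0 ≤ u Q) (hid : LinearMap.id = u.sum fun Q c => c • Q)
    (h1 : ∀ Q ∈ u.support, gramPairing (ContinuousLinearMap.id ℝ (Euc n)) Q = 1)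
    (hT : ∀ Q ∈ u.support, gramPairing T Q ≤ 1) : |LinearMap.det T.toLinearMap| ≤ 1 := by
  have key : ∀ T : Euc n →L[ℝ] Euc n,
      gramPairing T LinearMap.id = ∑ Q ∈ u.support, u Q * gramPairing T Q := fun T => by
    rw [hid, Finsupp.sum, map_sum]
    exact Finset.sum_congr rfl fun Q _ => by rw [map_smul, smul_eq_mul]
  refine abs_det_le_one T ?_
  rw [← gramPairing_id, key]
  have h2 : (n : ℝ) = ∑ Q ∈ u.support, u Q := by
    have h3 := key (ContinuousLinearMap.id ℝ (Euc n))
    have h4 : ∑ Q ∈ u.support, u Q * gramPairing (ContinuousLinearMap.id ℝ (Euc n)) Q =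
        ∑ Q ∈ u.support, u Q :=
      Finset.sum_congr rfl fun Q hQ => by rw [h1 Q hQ, mul_one]
    rw [gramPairing_id, h4] at h3
    rw [← h3]
    simp
  rw [h2]
  exact Finset.sum_le_sum fun Q hQ => mul_le_of_le_one_right (hu Q) (hT Q hQ)

theorem IsCriticalLattice.coe_eq_voronoiClass (hn : 1 ≤ n)
    (hL : IsCriticalLattice (unitBall n) L) {S : Finset (Euc n)} (hS : S ∈ maximalSimplices L)
    {p : Euc n} (hp : p ∈ S) : (S : Set (Euc n)) = voronoiClass L p := by
  obtain ⟨x, -, -, hSx⟩ := (hL.mem_maximalSimplices_iff hn).1 hS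
  rw [hSx, voronoiClass_eq_of_mem (hSx.le hp).2]

/-- At most one pair of opposite maximal simplices has a vertex at one of two given antipodal
points. -/
theorem IsCriticalLattice.exists_pair (hn : 1 ≤ n) (hL : IsCriticalLattice (unitBall n) L)
    (p : Euc n) : ∃ S₀ ∈ maximalSimplices L,
      ∀ S ∈ maximalSimplices L \ {S₀, negSimplex S₀}, p ∉ S ∧ -p ∉ S := by
  have huniq : ∀ S ∈ maximalSimplices L, ∀ S' ∈ maximalSimplices L, ∀ q, q ∈ S → q ∈ S' →
      S = S' := fun S hS S' hS' q hq hq' => Finset.coe_injective <| by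
    rw [hL.coe_eq_voronoiClass hn hS hq, hL.coe_eq_voronoiClass hn hS' hq']
  have hneg : ∀ S ∈ maximalSimplices L, ∀ S' ∈ maximalSimplices L, ∀ q, q ∈ S → -q ∈ S' →
      S = negSimplex S' := by
    intro S hS S' hS' q hq hq'
    ext y
    rw [mem_negSimplex, ← Finset.mem_coe, hL.coe_eq_voronoiClass hn hS hq, ← Finset.mem_coe,
      hL.coe_eq_voronoiClass hn hS' hq']
    refine and_congr ⟨neg_mem_voronoiPolytope, fun h => ?_⟩ ?_
    · simpa using neg_mem_voronoiPolytope h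
    · rw [← L.neg_mem_iff, show -(y - q) = -y - -q by abel]
  by_cases h : ∃ S₀ ∈ maximalSimplices L, p ∈ S₀ ∨ -p ∈ S₀
  · obtain ⟨S₀, hS₀, hp⟩ := h
    refine ⟨S₀, hS₀, fun S hS => ?_⟩
    obtain ⟨hSX, hSn⟩ := hS
    simp only [mem_insert_iff, mem_singleton_iff, not_or] at hSn
    rcases hp with hp | hp
    · exact ⟨fun h => hSn.1 (huniq _ hSX _ hS₀ p h hp),
        fun h => hSn.2 (hneg _ hSX _ hS₀ (-p) h (by rwa [neg_neg]))⟩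
    · exact ⟨fun h => hSn.2 (hneg _ hSX _ hS₀ p h hp),
        fun h => hSn.1 (huniq _ hSX _ hS₀ (-p) h hp)⟩
  · push Not at h
    obtain ⟨x, hx, hx1⟩ := hL.exists_norm_eq_one hn
    refine ⟨(hL.1.1.finite_voronoiClass hx).toFinset, (hL.mem_maximalSimplices_iff hn).2
      ⟨x, hx, hx1, Finite.coe_toFinset _⟩, fun S hS => h S hS.1⟩

/-- A perturbed maximal simplex without vertices at `p` and `-p` keeps circumradius at most one,
as long as the perturbed lattice covers with the ball enlarged by small caps at `p` and `-p`. -/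
theorem IsCriticalLattice.eventually_gramPairing_le (hn : 1 ≤ n)
    (hL : IsCriticalLattice (unitBall n) L) (hgen : Generic L) {S : Finset (Euc n)}
    (hS : S ∈ maximalSimplices L) {Q : Euc n →ₗ[ℝ] Euc n} (hQ : IsSimplexMap S Q) {p : Euc n}
    (hp1 : ‖p‖ = 1) (hpS : p ∉ S) (hpS' : -p ∉ S) :
    ∃ τ > 0, ∀ᶠ T : Euc n →L[ℝ] Euc n in 𝓝 (ContinuousLinearMap.id ℝ (Euc n)),
      (∀ y : Euc n, ∃ l ∈ L, ‖y - T l‖ ≤ 1 ∨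
        ‖y - T l - p‖ ≤ τ ∨ ‖y - T l + p‖ ≤ τ) → gramPairing T Q ≤ 1 := by
  have hLL := hL.1.1
  obtain ⟨x, hx, hx1, hSx⟩ := (hL.mem_maximalSimplices_iff hn).1 hS
  -- The points `x - l` stay away from `p` and from `-p`.
  have haway : ∀ q : Euc n, ‖q‖ = 1 → q ∉ S → ∃ g > 0, ∀ l ∈ L, g ≤ ‖x - l - q‖ := by
    intro q hq1 hq
    obtain ⟨g, hg, hgap⟩ := hLL.exists_gap (x - q) 0
    refine ⟨g, hg, fun l hl => ?_⟩
    by_contra! h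
    rw [sub_right_comm] at h
    have h1 := hgap l hl (by rwa [zero_add])
    have h2 : x - l = q := by
      rw [norm_le_zero_iff, sub_right_comm, sub_eq_zero] at h1
      exact h1
    refine hq (hSx.ge ⟨?_, ?_⟩)
    · rw [← h2]
      exact sub_mem_voronoiPolytope hx hl (by rw [h2, hq1, hx1])
    · rw [← h2]
      simpa using hl
  obtain ⟨g₁, hg₁, hp₁⟩ := haway p hp1 hpS
  obtain ⟨g₂, hg₂, hp₂⟩ := haway (-p) (by rw [norm_neg, hp1]) hpS'
  set σ := min 1 (min g₁ g₂ / 4) with hσ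
  have hσ0 : 0 < σ := by positivity
  have hσ1 : σ ≤ 1 := min_le_left _ _
  have hσg : σ ≤ min g₁ g₂ / 4 := min_le_right _ _
  have hσg₁ : 4 * σ ≤ g₁ := by linarith [min_le_left g₁ g₂]
  have hσg₂ : 4 * σ ≤ g₂ := by linarith [min_le_right g₁ g₂]
  refine ⟨σ, hσ0, ?_⟩
  filter_upwards [hgen.eventually_exists_center hLL (hL.1.mem_voronoiVertices hx hx1) hσ0,
    tendsto_norm_sub_id.eventually (eventually_lt_nhds (show (0 : ℝ) < σ / 6 by positivity)),
    eventually_det_ne_zero (n := n)] with T hT hTs hdet hcov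
  obtain ⟨z, hz, hzP⟩ := hT
  have hTl : ∀ v : Euc n, ‖T v - v‖ ≤ σ / 6 * ‖v‖ := fun v =>
    (norm_apply_sub_le T v).trans (mul_le_mul_of_nonneg_right hTs.le (norm_nonneg _))
  have hxc : x ∈ voronoiClass L x := ⟨hx, by simp⟩
  have hr : ∀ y ∈ S, ‖T y - z‖ = ‖T x - z‖ := by
    intro y hy
    have hyc := hSx.le hy
    refine norm_eq_of_mem_voronoiClass (hzP x hxc) ⟨hzP y hyc, ?_⟩
    exact ⟨y - x, hyc.2, by simp⟩
  have hfar : ∀ (q : Euc n) (l : Euc n), ‖q‖ = 1 → ‖T x - z - T l - q‖ ≤ σ →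
      ‖x - l - q‖ < 4 * σ := by
    intro q l hq1 h
    have h1 : ‖T (x - l)‖ ≤ 3 := by
      have h2 : T (x - l) = (T x - z - T l - q) + q + z := by rw [map_sub]; abel
      have h3 := norm_add₃_le (a := T x - z - T l - q) (b := q) (c := z)
      rw [← h2] at h3
      linarith
    have h2 : ‖x - l‖ ≤ 6 := by
      have h3 := norm_sub_le (T (x - l)) (T (x - l) - (x - l))
      rw [sub_sub_cancel] at h3
      have h4 := hTl (x - l)
      have h5 : σ / 6 * ‖x - l‖ ≤ 1 / 6 * ‖x - l‖ :=
        mul_le_mul_of_nonneg_right (by linarith) (norm_nonneg _)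
      linarith
    have h3 : x - l - q = (T x - z - T l - q) + z - (T (x - l) - (x - l)) := by
      rw [map_sub]; abel
    have h4 : ‖x - l - q‖ ≤ ‖T x - z - T l - q‖ + ‖z‖ + ‖T (x - l) - (x - l)‖ := by
      rw [h3]
      exact (norm_sub_le _ _).trans (add_le_add (norm_add_le _ _) le_rfl)
    have h5 : σ / 6 * ‖x - l‖ ≤ σ / 6 * 6 := mul_le_mul_of_nonneg_left h2 (by positivity)
    linarith [hTl (x - l)]
  obtain ⟨l, hl, h⟩ := hcov (T x - z)
  have hle : ‖T x - z‖ ≤ 1 := by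
    rcases h with h | h | h
    · exact (hzP x hxc (T l) ⟨l, hl, rfl⟩).trans h
    · linarith [hfar p l hp1 h, hp₁ l hl]
    · linarith [hfar (-p) l (by rw [norm_neg, hp1]) (by rwa [sub_neg_eq_add]), hp₂ l hl]
  exact (gramPairing_le hQ hr).trans (pow_le_one₀ (norm_nonneg _) hle)

end DetBound

/-! ### Redundant semi-eutaxy implies extensibility -/

section Extensible

variable {n : ℕ} {L₀ : Submodule ℤ (Euc n)}

/-- For a generic and unique critical lattice, redundancy makes the addition of sufficiently
small caps useless. -/
theorem IsUniqueCriticalLattice.extensible (hn : 1 ≤ n)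
    (hunique : IsUniqueCriticalLattice (unitBall n) L₀) (hgen : Generic L₀)
    (hred : RedundantlySemiEutactic (maximalSimplices L₀)) : Extensible (unitBall n) := by
  intro hinext
  have hcrit := hunique.1
  have hd0 : 0 < ZLattice.covolume L₀ := hcrit.1.1.covolume_pos
  obtain ⟨e, -, he1⟩ := hcrit.exists_norm_eq_one hn
  -- Covering lattices with larger determinant for balls with smaller and smaller caps.
  have hcap : ∀ k : ℕ, ∃ L : Submodule ℤ (Euc n),
      IsCoveringLattice (cappedBall ((1 + 1 / ((k : ℝ) + 1)) • e)) L ∧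
        ZLattice.covolume L₀ < ZLattice.covolume L := by
    intro k
    have hk : 0 < 1 / ((k : ℝ) + 1) := by positivity
    have hp : ‖(1 + 1 / ((k : ℝ) + 1)) • e‖ = 1 + 1 / ((k : ℝ) + 1) := by
      rw [norm_smul, he1, mul_one, Real.norm_of_nonneg (by positivity)]
    have hss : unitBall n ⊂ cappedBall ((1 + 1 / ((k : ℝ) + 1)) • e) := by
      refine (ssubset_iff_of_subset (unitBall_subset_cappedBall _)).2
        ⟨_, mem_cappedBall_self _, fun h => ?_⟩
      rw [unitBall, mem_closedBall_zero_iff, hp] at h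
      linarith
    have h1 := hinext _ (isSymmetricBody_cappedBall _) hss
    rw [← hcrit.2] at h1
    obtain ⟨_, ⟨L, hL, rfl⟩, hlt⟩ := exists_lt_of_lt_csSup
      (by
        refine ⟨_, L₀, ⟨hcrit.1.1, fun x => ?_⟩, rfl⟩
        obtain ⟨l, hl, hx⟩ := hcrit.1.2 x
        exact ⟨l, hl, unitBall_subset_cappedBall _ hx⟩) h1
    exact ⟨L, hL, hlt⟩
  choose Λ hΛ hΛvol using hcap
  set ε : ℕ → ℝ := fun k => 1 / ((k : ℝ) + 1) with hε
  have hε0 : ∀ k, 0 < ε k := fun k => by positivity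
  have hε1 : ∀ k, ε k ≤ 1 := fun k => by
    rw [hε, div_le_one (by positivity)]
    linarith [(Nat.cast_nonneg k : (0 : ℝ) ≤ k)]
  set F : Ultrafilter ℕ := hyperfilter ℕ with hF
  have hεlim : Tendsto ε F (𝓝 0) :=
    tendsto_one_div_add_atTop_nhds_zero_nat.mono_left Nat.hyperfilter_le_atTop
  have hpnorm : ∀ k, ‖(1 + ε k) • e‖ = 1 + ε k := fun k => by
    rw [norm_smul, he1, mul_one, Real.norm_of_nonneg (by linarith [hε0 k])]
  have hKnorm : ∀ k, ∀ x ∈ cappedBall ((1 + ε k) • e), ‖x‖ ≤ 1 + ε k := fun k x hx => by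
    rw [← hpnorm]
    exact norm_le_of_mem_cappedBall (by rw [hpnorm]; linarith [hε0 k]) hx
  have hΛ2 : ∀ k, IsCoveringLattice (Metric.closedBall 0 2) (Λ k) := fun k =>
    ⟨(hΛ k).1, fun x => by
      obtain ⟨l, hl, hx⟩ := (hΛ k).2 x
      exact ⟨l, hl, mem_closedBall_zero_iff.2 ((hKnorm k _ hx).trans (by linarith [hε1 k]))⟩⟩
  obtain ⟨hlat, T, hT, hTΛ⟩ := exists_tendsto_latticeImage F hΛ2 hd0 fun k => (hΛvol k).le
  set L := limitLattice F Λ with hLdef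
  have hTdet := hT.eventually (eventually_det_ne_zero (n := n))
  -- The limit lattice is critical.
  have hLcov : IsCoveringLattice (unitBall n) L := by
    refine ⟨hlat, fun x => ?_⟩
    choose l hl hx using fun k => (hΛ k).2 x
    have hxl : ∀ k, ‖x - l k‖ ≤ 1 + ε k := fun k => hKnorm k _ (hx k)
    obtain ⟨y, hy⟩ := exists_tendsto_of_norm_le F (u := l) (R := 2 + ‖x‖)
      (Eventually.of_forall fun k => by
        have h1 := norm_sub_le x (x - l k)
        rw [sub_sub_cancel] at h1
        linarith [hxl k, hε1 k])
    refine ⟨y, ⟨l, hl, hy⟩, mem_closedBall_zero_iff.2 ?_⟩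
    have h1 : Tendsto (fun k => 1 + ε k) F (𝓝 1) := by
      simpa using hεlim.const_add 1
    exact le_of_tendsto_of_tendsto' (hy.const_sub x).norm h1 hxl
  have hLcrit : IsCriticalLattice (unitBall n) L := by
    refine ⟨hLcov, le_antisymm (hLcov.covolume_le_criticalDet isCompact_unitBall) ?_⟩
    rw [← hcrit.2]
    have h1 : Tendsto (fun k => |LinearMap.det (T k).toLinearMap| * ZLattice.covolume L) F
        (𝓝 (ZLattice.covolume L)) := by
      have h2 := ((ContinuousLinearMap.continuous_det.tendsto _).comp hT).abs.mul_const
        (ZLattice.covolume L)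
      have h3 : |(ContinuousLinearMap.id ℝ (Euc n)).det| * ZLattice.covolume L =
          ZLattice.covolume L := by simp [ContinuousLinearMap.det]
      rw [h3] at h2
      exact h2
    refine ge_of_tendsto h1 ?_
    filter_upwards [hTΛ, hTdet] with k hk hdet
    rw [← covolume_latticeImage hlat hdet, ← hk]
    exact (hΛvol k).le
  obtain ⟨U, hU⟩ := hunique.2 L hLcrit
  -- Rotate so that the limit lattice becomes `L₀`; the caps are then at `p` and `-p`.
  set p := U.symm e with hp
  have hp1 : ‖p‖ = 1 := by rw [hp, U.symm.norm_map, he1]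
  have hUp : U p = e := U.apply_symm_apply e
  set T' : ℕ → Euc n →L[ℝ] Euc n := fun k =>
    (U.symm.toContinuousLinearEquiv : Euc n →L[ℝ] Euc n) ∘L T k ∘L
      (U.toContinuousLinearEquiv : Euc n →L[ℝ] Euc n) with hT'
  have hUT' : ∀ k v, U (T' k v) = T k (U v) := fun k v => U.apply_symm_apply _
  have hT'lim : Tendsto T' F (𝓝 (ContinuousLinearMap.id ℝ (Euc n))) := by
    have hc : Continuous fun R : Euc n →L[ℝ] Euc n =>
        (U.symm.toContinuousLinearEquiv : Euc n →L[ℝ] Euc n) ∘L R ∘L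
          (U.toContinuousLinearEquiv : Euc n →L[ℝ] Euc n) := by fun_prop
    have h1 := (hc.tendsto (ContinuousLinearMap.id ℝ (Euc n))).comp hT
    have h2 : (U.symm.toContinuousLinearEquiv : Euc n →L[ℝ] Euc n) ∘L
        (ContinuousLinearMap.id ℝ (Euc n)) ∘L
          (U.toContinuousLinearEquiv : Euc n →L[ℝ] Euc n) = ContinuousLinearMap.id ℝ (Euc n) :=
      ContinuousLinearMap.ext fun v => U.symm_apply_apply v
    rw [h2] at h1
    exact h1
  have hdetT' : ∀ k, LinearMap.det (T' k).toLinearMap = LinearMap.det (T k).toLinearMap := by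
    intro k
    have := LinearMap.det_conj (T k).toLinearMap U.symm.toLinearEquiv
    rw [← this]
    rfl
  obtain ⟨S₀, hS₀, hpair⟩ := hcrit.exists_pair hn p
  obtain ⟨u, husub, hu0, hid⟩ := hred S₀ hS₀
  have hev : ∀ Q ∈ u.support, ∀ᶠ k in (F : Filter ℕ), gramPairing (T' k) Q ≤ 1 := by
    intro Q hQ
    obtain ⟨S, hS, hSQ⟩ := husub hQ
    obtain ⟨hpS, hpS'⟩ := hpair S hS
    obtain ⟨τ, hτ, hev⟩ := hcrit.eventually_gramPairing_le hn hgen hS.1 hSQ hp1 hpS hpS'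
    have hsmall : ∀ᶠ k in (F : Filter ℕ), 3 * ε k ≤ (τ / 2) ^ 2 ∧ ε k ≤ τ / 2 := by
      have h1 : Tendsto (fun k => 3 * ε k) F (𝓝 0) := by simpa using hεlim.const_mul 3
      exact (h1.eventually_le_const (by positivity)).and
        (hεlim.eventually_le_const (by positivity))
    filter_upwards [hT'lim.eventually hev, hTΛ, hsmall] with k hk hΛk hεk
    refine hk fun y => ?_
    obtain ⟨l, hl, hyl⟩ := (hΛ k).2 (U y)
    rw [hΛk, hU] at hl
    obtain ⟨_, ⟨l₀, hl₀, rfl⟩, rfl⟩ := hl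
    refine ⟨l₀, hl₀, or_iff_not_imp_left.2 fun hgt => ?_⟩
    have hUy : U y - T k (U l₀) = U (y - T' k l₀) := by rw [map_sub, hUT']
    change U y - T k (U l₀) ∈ _ at hyl
    rw [hUy] at hyl
    rw [not_le, ← U.norm_map] at hgt
    have hcapε : ‖(1 + ε k) • e‖ ^ 2 - 1 ≤ (τ / 2) ^ 2 := by
      rw [hpnorm]
      nlinarith [hε0 k, hε1 k, hεk.1]
    have hclose : ∀ v : Euc n, ‖v - (1 + ε k) • e‖ ^ 2 ≤ (τ / 2) ^ 2 → ‖v - e‖ ≤ τ := by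
      intro v hv
      have h1 := (pow_le_pow_iff_left₀ (norm_nonneg _) (by positivity) two_ne_zero).1 hv
      have h2 : v - e = (v - (1 + ε k) • e) + ε k • e := by module
      rw [h2]
      refine (norm_add_le _ _).trans ?_
      rw [norm_smul, he1, mul_one, Real.norm_of_nonneg (hε0 k).le]
      linarith [hεk.2]
    rcases dist_sq_le_of_mem_cappedBall hyl hgt with h | h
    · left
      have h1 := hclose _ (h.trans hcapε)
      rwa [← hUp, ← map_sub, U.norm_map] at h1
    · right
      have h1 := hclose (-U (y - T' k l₀)) (by
        rw [← norm_neg, neg_sub, sub_neg_eq_add, add_comm]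
        exact h.trans hcapε)
      rwa [← norm_neg, neg_sub, sub_neg_eq_add, ← hUp, ← map_add, U.norm_map, add_comm] at h1
  have hone : ∀ Q ∈ u.support, gramPairing (ContinuousLinearMap.id ℝ (Euc n)) Q = 1 := by
    intro Q hQ
    obtain ⟨S, hS, hSQ⟩ := husub hQ
    obtain ⟨x, hx, hx1, hSx⟩ := (hcrit.mem_maximalSimplices_iff hn).1 hS.1
    exact gramPairing_id_eq_one hSQ fun y hy =>
      (norm_eq_of_mem_voronoiClass hx (hSx.le hy)).trans hx1
  obtain ⟨k, ⟨hk, hΛk⟩, hdet⟩ :=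
    (((Filter.eventually_all_finset u.support).2 hev).and hTΛ).and hTdet |>.exists
  have h1 := abs_det_le_one_of_eutactic hu0 hid hone hk
  rw [hdetT'] at h1
  have h2 := hΛvol k
  rw [hΛk, covolume_latticeImage hlat hdet, hLcrit.2, ← hcrit.2] at h2
  nlinarith

end Extensible

end BallCovering

theorem mainTheorem3 (n : ℕ) (hn : 1 ≤ n)
    (L₀ : Submodule ℤ (EuclideanSpace ℝ (Fin n)))
    (hunique : BallCovering.IsUniqueCriticalLattice (BallCovering.unitBall n) L₀)
    (hgeneric : BallCovering.Generic L₀) :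
    BallCovering.Extensible (BallCovering.unitBall n) ↔
      BallCovering.RedundantlySemiEutactic (BallCovering.maximalSimplices L₀) := by
  refine ⟨fun hext S hS => ?_, hunique.extensible hn hgeneric⟩
  by_contra hneut
  exact hext (hunique.1.inextensible hn hS hneut)
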